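/- Let $q$ be a prime power and let $\theta\colon x\mapsto x^q$ be the involutory automorphism of $\mathbb{F}_{q^2}$. A hermitian form on a vector space $V$ over $\mathbb{F}_{q^2}$ is a map $f\colon V\times V\to\mathbb{F}_{q^2}$ that is linear in the first argument, $\theta$-semilinear in the second, and satisfies $f(v,w)=f(w,v)^{\theta}$; its radical is $\{v : f(v,w)=0 \text{ for all } w\}$, and $f$ is non-degenerate if its radical is $\{0\}$. A $j$-space is a $j$-dimensional subspace; it is $i$-singular if the restriction of $f$ to it has an $i$-dimensional radical, and non-singular if it is $0$-singular. Given a non-degenerate hermitian form on $\mathbb{F}_{q^2}^n$ and an $i$-singular $j$-space $\pi$, let $\beta_{i,j,n,k}$ be the number of non-singular $k$-spaces containing $\pi$, and let $\gamma_{i,j,n,k}$ be the number of non-singular $k$-spaces $\sigma$ such that $\sigma\cap\pi=\{0\}$ and $\langle\pi,\sigma\rangle$ is a non-singular $(k+j)$-space. Write $\gamma_{i,j,n}=\gamma_{i,j,n,n-j}$. Put $$\varphi^{\pm}_{a,b}(q)=\prod_{t=a}^{b}\bigl(q^t\pm(-1)^t\bigr),\qquad \varphi^{\pm}_{a,a-1}(q)=1,$$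 $$\genfrac{[}{]}{0pt}{}{b}{a}^{-}_{q}=\frac{\varphi^{-}_{b-a+1,b}(q)}{\varphi^{-}_{1,a}(q)}\ \text{ for } b\ge a\ge 0,\qquad \genfrac{[}{]}{0pt}{}{b}{a}^{-}_{q}=0\ \text{ if } a<0 \text{ or } b<a.$$ **Theorem.** Let $i,j,n,k\geq 0$ be integers with $i\leq\min\{j,n-j\}$, $j\leq n-1$ and $k\leq n-j$. For every non-degenerate hermitian form on $\mathbb{F}_{q^2}^n$ and every $i$-singular $j$-space $\pi$ in $\mathbb{F}_{q^2}^n$, $$\gamma_{i,j,n,k}=\beta_{i,j,n,k+j}\,\gamma_{i,j,k+j},$$ where $\gamma_{i,j,k+j}$ may be computed from any non-degenerate hermitian form on $\mathbb{F}_{q^2}^{k+j}$ and any $i$-singular $j$-space in it (if $k<i$ there is no such space, and then $\gamma_{i,j,n,k}=\beta_{i,j,n,k+j}=0$). Moreover $$\gamma_{i,j,n,k}=q^{(n-k-j)(k+i)+2jk-\binom{j+1}{2}}\genfrac{[}{]}{0pt}{}{n-j-i}{n-k-j}^{-}_{q}\varphi^{+}_{1,i}(q)\sum_{m=0}^{j-i}(-1)^{mk}\varphi^{+}_{i+1,j-m}(q)\genfrac{[}{]}{0pt}{}{j-i}{m}^{-}_{q}\,q^{\binom{m}{2}-m(k-i)}.$$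 -/

import Mathlib

open scoped BigOperators

/-- The form `f`, linear in the first and `θ`-semilinear in the second argument, is hermitian:
`θ` is a field automorphism with `θ² = 1` and `θ ≠ 1`, and `f(v,w) = f(w,v)^θ`. -/
structure IsHermitianForm {K : Type*} [Field K] {θ : K →+* K} {V : Type*} [AddCommGroup V]
    [Module K V] (f : V →ₗ[K] V →ₛₗ[θ] K) : Prop where
  involutive : ∀ x : K, θ (θ x) = x
  ne_id : θ ≠ RingHom.id K
  symm : ∀ v w : V, f v w = θ (f w v)

/-- The radical `{v | ∀ w, f(v,w) = 0}` of a sesquilinear form. -/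
def formRadical {K : Type*} [Field K] {θ : K →+* K} {V : Type*} [AddCommGroup V]
    [Module K V] (f : V →ₗ[K] V →ₛₗ[θ] K) : Submodule K V :=
  LinearMap.ker f

theorem mem_formRadical {K : Type*} [Field K] {θ : K →+* K} {V : Type*} [AddCommGroup V]
    [Module K V] (f : V →ₗ[K] V →ₛₗ[θ] K) (v : V) :
    v ∈ formRadical f ↔ ∀ w : V, f v w = 0 := by
  simp [formRadical, LinearMap.ext_iff]

/-- A form is non-degenerate if its radical contains only the zero vector. -/
def IsNondegenerateForm {K : Type*} [Field K] {θ : K →+* K} {V : Type*} [AddCommGroup V]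
    [Module K V] (f : V →ₗ[K] V →ₛₗ[θ] K) : Prop :=
  formRadical f = ⊥

/-- `π` is an `i`-singular `j`-space: it has dimension `j`, and the restriction of `f` to `π` has
an `i`-dimensional radical. For `i = 0` it is a non-singular `j`-space. -/
def IsSingularSpace {K : Type*} [Field K] {θ : K →+* K} {V : Type*} [AddCommGroup V]
    [Module K V] (f : V →ₗ[K] V →ₛₗ[θ] K) (i j : ℕ) (π : Submodule K V) : Prop :=
  Module.finrank K π = j ∧ Module.finrank K (formRadical (f.domRestrict₁₂ π π)) = i

/-- The number of non-singular `k`-spaces containing `π`. For an `i`-singular `j`-space `π` with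
respect to a non-degenerate hermitian form on an `n`-dimensional space this is `β_{i,j,n,k}`. -/
noncomputable def betaCount {K : Type*} [Field K] {θ : K →+* K} {V : Type*} [AddCommGroup V]
    [Module K V] (f : V →ₗ[K] V →ₛₗ[θ] K) (π : Submodule K V) (k : ℕ) : ℕ :=
  Set.ncard {σ : Submodule K V | IsSingularSpace f 0 k σ ∧ π ≤ σ}

/-- The number of non-singular `k`-spaces that meet `π` trivially and span, together with `π`, a
non-singular space of dimension `k + dim π`. For an `i`-singular `j`-space `π` with respect to a
non-degenerate hermitian form on an `n`-dimensional space this is `γ_{i,j,n,k}`, and it is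
`γ_{i,j,n}` if moreover `n = k + j`. -/
noncomputable def gammaCount {K : Type*} [Field K] {θ : K →+* K} {V : Type*} [AddCommGroup V]
    [Module K V] (f : V →ₗ[K] V →ₛₗ[θ] K) (π : Submodule K V) (k : ℕ) : ℕ :=
  Set.ncard {σ : Submodule K V | IsSingularSpace f 0 k σ ∧ σ ⊓ π = ⊥ ∧
    IsSingularSpace f 0 (k + Module.finrank K π) (π ⊔ σ)}

/-- `φ⁺_{a,b}(q) = ∏_{k=a}^{b} (q^k + (-1)^k)`, an empty product for `b = a - 1`. -/
def phiPlus (a b : ℕ) (q : ℚ) : ℚ := ∏ k ∈ Finset.Icc a b, (q ^ k + (-1) ^ k)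

/-- `φ⁻_{a,b}(q) = ∏_{k=a}^{b} (q^k - (-1)^k)`, an empty product for `b = a - 1`. -/
def phiMinus (a b : ℕ) (q : ℚ) : ℚ := ∏ k ∈ Finset.Icc a b, (q ^ k - (-1) ^ k)

/-- The modified Gaussian coefficient `φ⁻_{b-a+1,b}(q) / φ⁻_{1,a}(q)`, which is zero for
`b < a`. -/
def gaussMinus (b a : ℕ) (q : ℚ) : ℚ :=
  if a ≤ b then phiMinus (b - a + 1) b q / phiMinus 1 a q else 0

/-! The factorisation comes from the map `σ ↦ π ⊔ σ`: its fibre over a non-singular space `ω ⊇ π` of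
dimension `k + j` is the same count inside `ω` (`gammaCount_eq_betaCount_mul`). It remains to find
`β`, and `γ` when `π` and `σ` span everything.

For `β`, orthogonality turns the spaces containing `π` into non-singular subspaces of `π^⊥`, whose
radical has dimension `i`; these are counted through their orthonormal bases
(`ncard_nonsingular_mul`), using the size of a hermitian sphere.

For `γ`, a complement `σ` of `π` corresponds to the basis `t` of `σ^⊥` dual to a fixed basis of `π`,
and `σ` is non-singular iff the Gram matrix of `t` is (`gammaCount_eq_natCard_dual`). In coordinates
adapted to `π`, this Gram matrix is an arbitrary matrix with blocks `1 + Y Yᴴ`, `C`, `Cᴴ`, `D`,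
where `D` is hermitian, and every triple `(Y, C, D)` arises equally often (`exists_equiv_formGram`).

The non-singular matrices of this shape are counted by a recursion (`hermCompletionCard_recursion`).
Such a matrix `M` is bordered in two ways: by a row extending `Y` and `C`, whose corner is `1 +
|y|²`, or by a free row with free hermitian corner. If `M` is singular, the proportion of
non-singular borders depends only on `ker M` and is the same both times. If `M` is non-singular, the
Schur complement reduces the first count to a sphere of a non-degenerate form and the second to
avoiding one corner value. The difference is a multiple of the count for `M` itself, and the Pascal
rule for the modified Gaussian coefficients solves the recursion. -/

theorem natCard_subtype_prod {S Z : Type*} [Fintype S] [Finite Z] (P : S → Z → Prop) :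
    Nat.card {p : S × Z // P p.1 p.2} = ∑ s, Nat.card {z // P s z} := by
  rw [← Nat.card_sigma]
  exact Nat.card_congr
    { toFun := fun p => ⟨p.1.1, p.1.2, p.2⟩
      invFun := fun p => ⟨(p.1, p.2.1), p.2.2⟩
      left_inv := fun _ => rfl
      right_inv := fun _ => rfl }

/-! ### Trace, norm and hermitian spheres over a finite field with involution. -/

section StarField

variable {K : Type*} [Field K] [StarRing K]

/-- Any element of non-zero trace can be normalised; this replaces `1/2` and so covers
characteristic 2. -/
theorem exists_add_star_eq_one (hs : ∃ x : K, star x ≠ x) : ∃ l : K, l + star l = 1 := by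
  obtain ⟨x, hx⟩ := hs
  obtain ⟨y, hy⟩ : ∃ y : K, y + star y ≠ 0 := by
    -- If all traces vanished, `1` would force characteristic 2, and then `star x = -x = x`.
    by_contra! h
    have h1 := h 1
    have hx' := h x
    rw [star_one] at h1
    apply hx
    linear_combination hx' - x * h1
  refine ⟨y / (y + star y), ?_⟩
  rw [star_div₀, star_add, star_star, add_comm (star y) y, ← add_div, div_self hy]

theorem exists_star_eq_neg (hs : ∃ x : K, star x ≠ x) : ∃ d : K, d ≠ 0 ∧ star d = -d := by
  obtain ⟨x, hx⟩ := hs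
  exact ⟨x - star x, sub_ne_zero.2 hx.symm, by rw [star_sub, star_star, neg_sub]⟩

/-- Every element is determined by its hermitian part `x + star x` and by a second self-adjoint
element, and both are arbitrary. -/
theorem exists_equiv_selfAdjoint_prod (hs : ∃ x : K, star x ≠ x) (A : Type*) [AddCommGroup A]
    [StarAddMonoid A] [Module K A] [StarModule K A] :
    ∃ e : A ≃ selfAdjoint A × selfAdjoint A, ∀ x, ((e x).1 : A) = x + star x := by
  obtain ⟨l, hl⟩ := exists_add_star_eq_one hs
  obtain ⟨d, hd0, hd⟩ := exists_star_eq_neg hs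
  have hl' : star l = 1 - l := by rw [← hl]; ring
  -- As `l + star l = 1`, the element `x - l • (x + star x)` is skew; dividing by the skew scalar
  -- `d` makes it self-adjoint.
  refine ⟨{ toFun := fun x => (⟨x + star x, ?_⟩, ⟨d⁻¹ • (x - l • (x + star x)), ?_⟩)
            invFun := fun p => l • (p.1 : A) + d • (p.2 : A)
            left_inv := fun x => ?_
            right_inv := fun p => ?_ }, fun x => rfl⟩
  · rw [selfAdjoint.mem_iff, star_add, star_star, add_comm]
  · rw [selfAdjoint.mem_iff, star_smul, star_inv₀, hd, star_sub, star_smul, star_add, star_star,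
      hl',
      inv_neg]
    module
  · simp only [smul_smul, mul_inv_cancel₀ hd0, one_smul]
    abel
  · obtain ⟨⟨s, hs⟩, ⟨t, ht⟩⟩ := p
    rw [selfAdjoint.mem_iff] at hs ht
    have h1 : l • s + d • t + star (l • s + d • t) = s := by
      rw [star_add, star_smul, star_smul, hs, ht, hl', hd]
      module
    simp only [h1, Prod.mk.injEq, Subtype.mk.injEq, true_and]
    rw [add_sub_cancel_left, smul_smul, inv_mul_cancel₀ hd0, one_smul]

theorem natCard_selfAdjoint_sq (hs : ∃ x : K, star x ≠ x) (A : Type*) [AddCommGroup A]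
    [StarAddMonoid A] [Module K A] [StarModule K A] :
    Nat.card A = Nat.card (selfAdjoint A) ^ 2 := by
  obtain ⟨e, -⟩ := exists_equiv_selfAdjoint_prod hs A
  rw [Nat.card_congr e, Nat.card_prod, sq]

theorem natCard_selfAdjoint (hs : ∃ x : K, star x ≠ x) {q : ℕ} (hq : Nat.card K = q ^ 2) :
    Nat.card (selfAdjoint K) = q := by
  have h := natCard_selfAdjoint_sq hs K
  rw [hq] at h
  exact (Nat.pow_left_injective two_ne_zero h).symm

theorem natCard_selfAdjoint_matrix (hs : ∃ x : K, star x ≠ x) {q : ℕ} (hq : Nat.card K = q ^ 2)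
    (ι : Type*) [Fintype ι] :
    Nat.card (selfAdjoint (Matrix ι ι K)) = q ^ (Fintype.card ι ^ 2) := by
  have h := natCard_selfAdjoint_sq hs (Matrix ι ι K)
  have h2 : Nat.card (Matrix ι ι K) = (q ^ (Fintype.card ι ^ 2)) ^ 2 := by
    change Nat.card (ι → ι → K) = _
    simp only [Nat.card_fun, hq, Nat.card_eq_fintype_card]
    ring
  rw [h2] at h
  exact (Nat.pow_left_injective two_ne_zero h).symm

theorem two_le_of_natCard {K : Type*} [Field K] [Finite K] {q : ℕ}
    (hq : Nat.card K = q ^ 2) : 2 ≤ q := by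
  have : 1 < Nat.card K := Finite.one_lt_card
  rw [hq] at this
  by_contra! h
  interval_cases q <;> simp at this

/-- The norm `x ↦ x * star x` on units. -/
def starNormHom (K : Type*) [Field K] [StarRing K] : Kˣ →* Kˣ :=
  MonoidHom.mk' (fun x => x * star x) fun x y => by
    rw [star_mul, mul_comm (star y)]; exact mul_mul_mul_comm _ _ _ _

/-- The quotient `x ↦ x / star x` on units. -/
def starQuotHom (K : Type*) [Field K] [StarRing K] : Kˣ →* Kˣ :=
  MonoidHom.mk' (fun x => x / star x) fun x y => by
    rw [star_mul, mul_comm (star y)]; exact mul_div_mul_comm ..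

theorem mem_ker_starNormHom {u : Kˣ} :
    u ∈ (starNormHom K).ker ↔ (u : K) * star (u : K) = 1 := by
  rw [MonoidHom.mem_ker, Units.ext_iff]
  rfl

theorem mem_ker_starQuotHom {u : Kˣ} : u ∈ (starQuotHom K).ker ↔ star (u : K) = u := by
  rw [MonoidHom.mem_ker]
  change u / star u = 1 ↔ _
  rw [div_eq_one, Units.ext_iff, Units.coe_star, eq_comm]

theorem coe_starQuotHom (u : Kˣ) : (starQuotHom K u : K) = u / star (u : K) := by
  rw [← Units.coe_star, ← Units.val_div_eq_div_val]
  rfl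

/-- Hilbert 90: for `x * star x = 1` the element `y = 1 + x` satisfies `y / star y = x`; a skew
element takes over when `x = -1`. -/
theorem ker_starNormHom (hs : ∃ x : K, star x ≠ x) :
    (starNormHom K).ker = (starQuotHom K).range := by
  ext x
  rw [mem_ker_starNormHom, MonoidHom.mem_range]
  constructor
  · intro h
    by_cases hx : (x : K) = -1
    · obtain ⟨d, hd0, hd⟩ := exists_star_eq_neg hs
      refine ⟨Units.mk0 d hd0, Units.ext ?_⟩
      rw [coe_starQuotHom, Units.val_mk0, hd, hx, div_neg, div_self hd0]
    · have h1 : 1 + (x : K) ≠ 0 := fun h => hx (by linear_combination h)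
      refine ⟨Units.mk0 _ h1, Units.ext ?_⟩
      have h2 : star (1 + (x : K)) ≠ 0 := star_ne_zero.2 h1
      rw [coe_starQuotHom, Units.val_mk0, div_eq_iff h2, star_add, star_one]
      linear_combination -h
  · rintro ⟨y, rfl⟩
    have hy : star (y : K) ≠ 0 := star_ne_zero.2 y.ne_zero
    rw [coe_starQuotHom, star_div₀, star_star]
    field_simp

/-- The number of vectors of length `r` whose standard hermitian norm is `s`. -/
noncomputable def sphereCard (r : ℕ) (s : K) : ℕ :=
  Nat.card {v : Fin r → K // ∑ b, v b * star (v b) = s}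

theorem sphereCard_zero (s : K) [Decidable (s = 0)] :
    sphereCard 0 s = if s = 0 then 1 else 0 := by
  unfold sphereCard
  split_ifs with h
  · subst h
    rw [Nat.card_eq_one_iff_unique]
    exact ⟨inferInstance, ⟨⟨0, by simp⟩⟩⟩
  · rw [Nat.card_eq_zero]
    left
    exact ⟨fun v => h (by simpa using v.2.symm)⟩

variable [Finite K]

/-- Surjectivity of the norm onto the fixed field. Hilbert 90 and the orders of the two
homomorphisms give equal cardinalities, so the evident inclusion is an equality. -/
theorem range_starNormHom (hs : ∃ x : K, star x ≠ x) :
    (starNormHom K).range = (starQuotHom K).ker := by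
  have hle : (starNormHom K).range ≤ (starQuotHom K).ker := by
    rintro _ ⟨y, rfl⟩
    rw [mem_ker_starQuotHom]
    change star ((y : K) * star (y : K)) = (y : K) * star (y : K)
    rw [star_mul, star_star]
  refine SetLike.coe_injective (Set.eq_of_subset_of_ncard_le hle ?_ (Set.toFinite _))
  have h1 := (starNormHom K).ker.card_mul_index
  have h2 := (starQuotHom K).ker.card_mul_index
  rw [Subgroup.index_ker] at h1 h2
  rw [ker_starNormHom hs, ← h2, mul_comm] at h1
  exact (Nat.eq_of_mul_eq_mul_right Nat.card_pos h1).ge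

theorem exists_mul_star_eq (hs : ∃ x : K, star x ≠ x) {s : K} (h : star s = s) :
    ∃ x : K, x * star x = s := by
  by_cases h0 : s = 0
  · exact ⟨0, by simp [h0]⟩
  have hm : Units.mk0 s h0 ∈ (starQuotHom K).ker := mem_ker_starQuotHom.2 h
  rw [← range_starNormHom hs] at hm
  obtain ⟨y, hy⟩ := hm
  exact ⟨y, congrArg Units.val hy⟩

/-- The fibre is a coset of the norm kernel, of order `(q² - 1) / (q - 1)`. -/
theorem natCard_mul_star_eq (hs : ∃ x : K, star x ≠ x) {q : ℕ} (hq : Nat.card K = q ^ 2) {s : K}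
    (h : star s = s) (h0 : s ≠ 0) : Nat.card {x : K // x * star x = s} = q + 1 := by
  obtain ⟨y, hy⟩ := exists_mul_star_eq hs h
  have hy0 : y ≠ 0 := by rintro rfl; simp at hy; exact h0 hy.symm
  have hys : star y ≠ 0 := star_ne_zero.2 hy0
  have q2 := two_le_of_natCard hq
  have hfix : Nat.card (starQuotHom K).ker + 1 = q := by
    rw [← natCard_selfAdjoint hs hq]
    classical
    -- The added point of `Option` stands for the zero of the fixed field.
    rw [← Finite.card_option]
    have h1 (u : (starQuotHom K).ker) : ((u : Kˣ) : K) ∈ selfAdjoint K :=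
      selfAdjoint.mem_iff.2 (mem_ker_starQuotHom.1 u.2)
    have h2 (x : selfAdjoint K) (hx : (x : K) ≠ 0) : Units.mk0 (x : K) hx ∈ (starQuotHom K).ker :=
      mem_ker_starQuotHom.2 (selfAdjoint.mem_iff.1 x.2)
    refine Nat.card_congr
      { toFun := fun o => o.elim 0 fun u => ⟨_, h1 u⟩
        invFun := fun x => if hx : (x : K) = 0 then none else some ⟨_, h2 x hx⟩
        left_inv := ?_
        right_inv := ?_ }
    · rintro (_ | u)
      · simp
      · simp
    · intro x
      by_cases hx : (x : K) = 0
      · simp only [hx, dite_true]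
        exact Subtype.ext hx.symm
      · simp [hx]
  have hker : Nat.card (starNormHom K).ker = q + 1 := by
    have h1 := (starNormHom K).ker.card_mul_index
    rw [Subgroup.index_ker, range_starNormHom hs, Nat.card_units, hq] at h1
    obtain ⟨p, rfl⟩ : ∃ p, q = p + 1 := ⟨q - 1, by omega⟩
    rw [add_left_inj] at hfix
    rw [hfix] at h1
    refine Nat.eq_of_mul_eq_mul_right (by omega : 0 < p) (h1.trans ?_)
    rw [Nat.sub_eq_iff_eq_add (Nat.one_le_pow _ _ (by omega))]
    ring
  rw [← hker]
  have h1 (u : (starNormHom K).ker) : y * ((u : Kˣ) : K) * star (y * ((u : Kˣ) : K)) = s := by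
    rw [star_mul, ← hy]
    linear_combination y * star y * mem_ker_starNormHom.1 u.2
  have h2 (x : {x : K // x * star x = s}) : (x : K) / y ≠ 0 := by
    refine div_ne_zero (fun hx => h0 ?_) hy0
    rw [← x.2, hx, zero_mul]
  have h3 (x : {x : K // x * star x = s}) : Units.mk0 _ (h2 x) ∈ (starNormHom K).ker := by
    rw [mem_ker_starNormHom, Units.val_mk0, star_div₀, div_mul_div_comm, x.2, hy, div_self h0]
  refine (Nat.card_congr
    { toFun := fun u => ⟨_, h1 u⟩
      invFun := fun x => ⟨_, h3 x⟩
      left_inv := fun u => ?_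
      right_inv := fun x => ?_ }).symm
  · ext
    simp [hy0]
  · ext
    simp [mul_div_cancel₀, hy0]

/-- One coordinate is split off. Its norm takes each non-zero fixed value `q + 1` times and the
value 0 once, while the spheres of all fixed values partition the `q ^ (2 * r)` remaining vectors.
-/
theorem sphereCard_succ (hs : ∃ x : K, star x ≠ x) {q : ℕ} (hq : Nat.card K = q ^ 2) (r : ℕ)
    {s : K} (h : star s = s) :
    (sphereCard (r + 1) s : ℚ) = (q + 1) * q ^ (2 * r) - q * sphereCard r s := by
  classical
  have := Fintype.ofFinite K
  have h1 : sphereCard (r + 1) s = ∑ y : K, sphereCard r (s - y * star y) := by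
    unfold sphereCard
    rw [← natCard_subtype_prod fun (y : K) (v : Fin r → K) =>
      ∑ b, v b * star (v b) = s - y * star y]
    refine Nat.card_congr ((Fin.consEquiv fun _ => K).symm.subtypeEquiv fun v => ?_)
    rw [Fin.sum_univ_succ, eq_sub_iff_add_eq, add_comm]
    rfl
  have h2 : ∑ u ∈ Finset.univ.filter (fun u : K => star u = u), sphereCard r (s - u)
      = q ^ (2 * r) := by
    have : q ^ (2 * r) = Fintype.card (Fin r → K) := by
      rw [← Nat.card_eq_fintype_card, Nat.card_fun, hq, Nat.card_eq_fintype_card, Fintype.card_fin,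
        pow_mul]
    rw [this, ← Finset.card_univ, Finset.card_eq_sum_card_fiberwise
      (f := fun v : Fin r → K => s - ∑ b, v b * star (v b))
      (t := Finset.univ.filter (fun u : K => star u = u))]
    · refine Finset.sum_congr rfl fun u _ => ?_
      unfold sphereCard
      rw [Nat.subtype_card]
      intro v
      simp only [Finset.mem_filter, Finset.mem_univ, true_and]
      rw [eq_sub_iff_add_eq, sub_eq_iff_eq_add, eq_comm, add_comm]
    · intro v _
      simp [h, mul_comm]
  have h3 : ∑ y : K, sphereCard r (s - y * star y) + q * sphereCard r s
      = (q + 1) * ∑ u ∈ Finset.univ.filter (fun u : K => star u = u), sphereCard r (s - u) := by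
    rw [← Finset.sum_fiberwise_of_maps_to (s := Finset.univ) (g := fun y : K => y * star y)
      (t := Finset.univ.filter (fun u : K => star u = u)) (by intro y _; simp [mul_comm])]
    have : ∀ u ∈ Finset.univ.filter (fun u : K => star u = u),
        ∑ y ∈ Finset.univ.filter (fun y : K => y * star y = u), sphereCard r (s - y * star y)
          = (if u = 0 then 1 else q + 1) * sphereCard r (s - u) := by
      intro u hu
      rw [Finset.sum_congr rfl (g := fun _ => sphereCard r (s - u))
        (by intro y hy; rw [(Finset.mem_filter.1 hy).2]), Finset.sum_const, smul_eq_mul]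
      congr 1
      split_ifs with h0
      · subst h0
        rw [Finset.card_eq_one]
        refine ⟨0, ?_⟩
        ext y
        simp
      · rw [← natCard_mul_star_eq hs hq (Finset.mem_filter.1 hu).2 h0, Nat.subtype_card]
        simp
    rw [Finset.sum_congr rfl this]
    have h0 : (0 : K) ∈ Finset.univ.filter (fun u : K => star u = u) := by simp
    rw [← Finset.add_sum_erase _ _ h0, ← Finset.add_sum_erase _ (fun u => sphereCard r (s - u)) h0,
      mul_add, Finset.mul_sum]
    rw [Finset.sum_congr rfl (g := fun u => (q + 1) * sphereCard r (s - u))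
      (by intro u hu; rw [if_neg (Finset.ne_of_mem_erase hu)])]
    simp
    ring
  have h3' := congrArg (Nat.cast : ℕ → ℚ) h3
  rw [h2, ← h1] at h3'
  push_cast at h3'
  linear_combination h3'

/-- The factor `q⁻¹`, rather than an exponent `r - 1`, keeps the formula valid at `r = 0`. -/
theorem sphereCard_eq_of_ne_zero (hs : ∃ x : K, star x ≠ x) {q : ℕ} (hq : Nat.card K = q ^ 2)
    (r : ℕ) {s : K} (h : star s = s) (h0 : s ≠ 0) :
    (sphereCard r s : ℚ) = (q : ℚ)⁻¹ * q ^ r * (q ^ r - (-1) ^ r) := by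
  classical
  have q2 := two_le_of_natCard hq
  have hq0 : (q : ℚ) ≠ 0 := by positivity
  induction r with
  | zero => rw [sphereCard_zero, if_neg h0]; simp
  | succ r ih =>
    rw [sphereCard_succ hs hq r h, ih]
    field_simp
    ring

end StarField

/-! ### Orthonormal families for hermitian forms. -/

section Forms

variable {K : Type*} [Field K] [StarRing K] {V : Type*} [AddCommGroup V] [Module K V]
  {f : V →ₗ[K] V →ₗ⋆[K] K}

theorem sesq_smul_left (f : V →ₗ[K] V →ₗ⋆[K] K) (c : K) (v w : V) :
    f (c • v) w = c * f v w := by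
  rw [map_smul, LinearMap.smul_apply, smul_eq_mul]

theorem sesq_smul_right (f : V →ₗ[K] V →ₗ⋆[K] K) (c : K) (v w : V) :
    f v (c • w) = star c * f v w := by
  rw [map_smulₛₗ, smul_eq_mul, starRingEnd_apply]

theorem IsHermitianForm.exists_star_ne (hf : IsHermitianForm f) : ∃ x : K, star x ≠ x := by
  by_contra! h
  exact hf.ne_id (RingHom.ext h)

theorem IsHermitianForm.star_apply (hf : IsHermitianForm f) (v w : V) : star (f v w) = f w v :=
  (hf.symm w v).symm

theorem IsHermitianForm.eq_zero_comm (hf : IsHermitianForm f) {v w : V} :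
    f v w = 0 ↔ f w v = 0 := by
  rw [← hf.star_apply, star_eq_zero]

theorem IsHermitianForm.domRestrict (hf : IsHermitianForm f) (U : Submodule K V) :
    IsHermitianForm (f.domRestrict₁₂ U U) where
  involutive := hf.involutive
  ne_id := hf.ne_id
  symm v w := hf.symm v w

theorem IsNondegenerateForm.eq_zero (h : IsNondegenerateForm f) {v : V} (hv : ∀ w, f v w = 0) :
    v = 0 := by
  have : v ∈ formRadical f := (mem_formRadical f v).2 hv
  rwa [h, Submodule.mem_bot] at this

/-- The family `e` is orthonormal with respect to `f`. -/
def IsOrthonormalFor {ι : Type*} [DecidableEq ι] (f : V →ₗ[K] V →ₗ⋆[K] K) (e : ι → V) : Prop :=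
  ∀ b c, f (e b) (e c) = if b = c then 1 else 0

section

variable {ι : Type*} [DecidableEq ι] [Fintype ι] {e : ι → V}

theorem IsOrthonormalFor.apply_sum_left (he : IsOrthonormalFor f e) (x : ι → K) (c : ι) :
    f (∑ b, x b • e b) (e c) = x c := by
  simp [map_sum, LinearMap.sum_apply, he _ _]

theorem IsOrthonormalFor.linearIndependent (he : IsOrthonormalFor f e) :
    LinearIndependent K e := by
  rw [Fintype.linearIndependent_iff]
  intro x hx c
  rw [← he.apply_sum_left x c, hx, map_zero, LinearMap.zero_apply]

theorem IsOrthonormalFor.apply_sum_sum (he : IsOrthonormalFor f e) (x y : ι → K) :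
    f (∑ b, x b • e b) (∑ b, y b • e b) = ∑ b, x b * star (y b) := by
  rw [map_sum]
  refine Finset.sum_congr rfl fun c _ => ?_
  rw [map_smulₛₗ, he.apply_sum_left, smul_eq_mul, starRingEnd_apply, mul_comm]

end

/-- If `v` and `w` are isotropic, then `(l / f v w) • v + w` has value `l + star l = 1`. -/
theorem IsHermitianForm.exists_apply_self_ne_zero (hf : IsHermitianForm f) {U : Submodule K V}
    {v w : V} (hv : v ∈ U) (hw : w ∈ U) (h : f v w ≠ 0) : ∃ u ∈ U, f u u ≠ 0 := by
  obtain ⟨l, hl⟩ := exists_add_star_eq_one hf.exists_star_ne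
  by_contra! hu
  have h1 := hu _ (U.add_mem (U.smul_mem (l / f v w) hv) hw)
  have h2 := hu v hv
  have h3 := hu w hw
  rw [map_add, map_add, LinearMap.add_apply, LinearMap.add_apply, sesq_smul_right,
    sesq_smul_left, sesq_smul_left, sesq_smul_right, h2, h3, ← hf.star_apply v w, star_div₀] at h1
  simp only [mul_zero, zero_add, add_zero] at h1
  rw [div_mul_cancel₀ _ h, div_mul_cancel₀ _ (star_ne_zero.2 h), add_comm, hl] at h1
  exact one_ne_zero h1

theorem IsHermitianForm.exists_apply_self_eq_one [Finite K] (hf : IsHermitianForm f)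
    {U : Submodule K V} {v w : V} (hv : v ∈ U) (hw : w ∈ U) (h : f v w ≠ 0) :
    ∃ u ∈ U, f u u = 1 := by
  obtain ⟨u, hu, h0⟩ := hf.exists_apply_self_ne_zero hv hw h
  have hst : star (f u u)⁻¹ = (f u u)⁻¹ := by rw [star_inv₀, hf.star_apply]
  obtain ⟨x, hx⟩ := exists_mul_star_eq hf.exists_star_ne hst
  refine ⟨x • u, U.smul_mem x hu, ?_⟩
  rw [sesq_smul_left, sesq_smul_right, ← mul_assoc, hx, inv_mul_cancel₀ h0]

/-- A hermitian form is the orthogonal sum of its radical and of a space with an orthonormal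
basis. -/
theorem IsHermitianForm.exists_isOrthonormalFor [Finite K] [FiniteDimensional K V]
    (hf : IsHermitianForm f) : ∃ (a : ℕ) (e : Fin a → V), IsOrthonormalFor f e ∧
      ∀ v, v - ∑ b, f v (e b) • e b ∈ formRadical f := by
  classical
  let P : ℕ → Prop := fun a => ∃ e : Fin a → V, IsOrthonormalFor f e
  have h0 : P 0 := ⟨Fin.elim0, fun b => b.elim0⟩
  obtain ⟨e, he⟩ := Nat.findGreatest_spec (P := P) (Nat.zero_le (Module.finrank K V)) h0
  refine ⟨_, e, he, fun v => ?_⟩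
  let U : Submodule K V :=
    { carrier := {u | ∀ b, f u (e b) = 0}
      add_mem' := fun hx hy b => by rw [map_add, LinearMap.add_apply, hx, hy, add_zero]
      zero_mem' := fun b => by rw [map_zero, LinearMap.zero_apply]
      smul_mem' := fun c x hx b => by rw [map_smul, LinearMap.smul_apply, hx, smul_zero] }
  have hproj : ∀ v, v - ∑ b, f v (e b) • e b ∈ U := by
    intro v b
    rw [map_sub, LinearMap.sub_apply, he.apply_sum_left, sub_self]
  -- Otherwise `U` contains a unit vector, which lengthens the longest orthonormal family `e`.
  have hU : ∀ v ∈ U, ∀ w ∈ U, f v w = 0 := by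
    intro v hv w hw
    by_contra hne
    obtain ⟨u, hu, hu1⟩ := hf.exists_apply_self_eq_one hv hw hne
    have hP : P (Nat.findGreatest P (Module.finrank K V) + 1) := by
      refine ⟨Fin.cons u e, fun b c => ?_⟩
      refine Fin.cases ?_ (fun b => ?_) b <;> refine Fin.cases ?_ (fun c => ?_) c
      · simpa using hu1
      · simpa [(Fin.succ_ne_zero c).symm] using hu c
      · simpa [Fin.succ_ne_zero b] using hf.eq_zero_comm.1 (hu b)
      · simpa using he b c
    have hle := hP.choose_spec.linearIndependent.fintype_card_le_finrank
    rw [Fintype.card_fin] at hle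
    have := Nat.le_findGreatest hle hP
    omega
  rw [mem_formRadical]
  intro w
  have hw : w = (w - ∑ b, f w (e b) • e b) + ∑ b, f w (e b) • e b := by abel
  rw [hw, map_add, hU _ (hproj v) _ (hproj w), zero_add, map_sum]
  refine Finset.sum_eq_zero fun b _ => ?_
  rw [map_smulₛₗ, hproj v b, smul_zero]

theorem IsOrthonormalFor.finrank_eq {ι : Type*} [DecidableEq ι] [Fintype ι] {e : ι → V}
    [FiniteDimensional K V] (he : IsOrthonormalFor f e)
    (h : ∀ v, v - ∑ b, f v (e b) • e b ∈ formRadical f) :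
    Module.finrank K V = Fintype.card ι + Module.finrank K (formRadical f) := by
  let g : V →ₗ[K] (ι → K) := LinearMap.pi fun b => f.flip (e b)
  have hg : ∀ v b, g v b = f v (e b) := fun _ _ => rfl
  have h1 : LinearMap.range g = ⊤ := by
    rw [LinearMap.range_eq_top]
    intro x
    exact ⟨∑ b, x b • e b, funext fun c => he.apply_sum_left x c⟩
  have h2 : LinearMap.ker g = formRadical f := by
    ext v
    rw [LinearMap.mem_ker]
    constructor
    · intro hv
      have := h v
      have h0 : ∀ b, f v (e b) = 0 := fun b => by rw [← hg, hv]; rfl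
      simpa [h0] using this
    · intro hv
      rw [mem_formRadical] at hv
      exact funext fun b => hv _
  rw [← LinearMap.finrank_range_add_finrank_ker g, h1, h2, finrank_top, Module.finrank_pi]

/-- A non-degenerate hermitian form has an orthonormal basis. -/
theorem IsHermitianForm.exists_orthonormal_coordinates [Finite K] [FiniteDimensional K V]
    (hf : IsHermitianForm f) (hnd : IsNondegenerateForm f) :
    ∃ g : V ≃ₗ[K] (Fin (Module.finrank K V) → K), ∀ v w, f v w = ∑ b, g v b * star (g w b) := by
  obtain ⟨a, e, he, h⟩ := hf.exists_isOrthonormalFor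
  have ha := he.finrank_eq h
  rw [hnd, finrank_bot, Fintype.card_fin, add_zero] at ha
  subst ha
  have h' : ∀ v, v = ∑ b, f v (e b) • e b := fun v => by
    have := h v
    rw [hnd, Submodule.mem_bot] at this
    exact sub_eq_zero.1 this
  let g : V →ₗ[K] (Fin _ → K) := LinearMap.pi fun b => f.flip (e b)
  refine ⟨LinearEquiv.ofBijective g ⟨?_, ?_⟩, fun v w => ?_⟩
  · rw [← LinearMap.ker_eq_bot, LinearMap.ker_eq_bot']
    intro v hv
    rw [h' v]
    refine Finset.sum_eq_zero fun b _ => ?_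
    have : f v (e b) = 0 := congrFun hv b
    rw [this, zero_smul]
  · intro x
    exact ⟨∑ b, x b • e b, funext fun c => he.apply_sum_left x c⟩
  · conv_lhs => rw [h' v, h' w]
    exact he.apply_sum_sum _ _

theorem IsHermitianForm.natCard_apply_self_eq [Finite K] [FiniteDimensional K V]
    (hf : IsHermitianForm f) (hnd : IsNondegenerateForm f) (s : K) :
    Nat.card {v : V // f v v = s} = sphereCard (Module.finrank K V) s := by
  obtain ⟨g, hg⟩ := hf.exists_orthonormal_coordinates hnd
  exact Nat.card_congr (g.toEquiv.subtypeEquiv fun v => by rw [hg]; rfl)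

end Forms

/-! ### Bordering a hermitian matrix by one row and column. -/

section Border

open Matrix

variable {K : Type*} [Field K] [StarRing K] {β : Type} [Fintype β] [DecidableEq β]

/-- The hermitian matrix `M` bordered by the column `v`, the row `star v` and the corner `d`. -/
def hermBorder (M : Matrix β β K) (v : β → K) (d : K) : Matrix (β ⊕ Unit) (β ⊕ Unit) K :=
  fromBlocks M (of fun b _ => v b) (of fun _ b => star (v b)) (of fun _ _ => d)

theorem det_hermBorder_ne_zero_of_det_ne_zero {M : Matrix β β K} (hM : M.det ≠ 0) (v : β → K)
    (d : K) : (hermBorder M v d).det ≠ 0 ↔ d ≠ star v ⬝ᵥ M⁻¹ *ᵥ v := by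
  let _ := M.invertibleOfIsUnitDet (isUnit_iff_ne_zero.2 hM)
  rw [hermBorder, det_fromBlocks₁₁, mul_ne_zero_iff, det_unique (n := Unit), Matrix.sub_apply,
    invOf_eq_nonsing_inv, sub_ne_zero, Matrix.mul_assoc]
  refine (and_iff_right hM).trans (Iff.of_eq ?_)
  congr 1

/-- When `M` is singular the corner `d` is irrelevant: only the pairing of `v` with `ker M` matters.
-/
theorem det_hermBorder_ne_zero_of_det_eq_zero {M : Matrix β β K} (hM : M.IsHermitian)
    (h0 : M.det = 0) (v : β → K) (d : K) :
    (hermBorder M v d).det ≠ 0 ↔ ∀ x, x ≠ 0 → M *ᵥ x = 0 → star x ⬝ᵥ v ≠ 0 := by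
  have hmul (x : β → K) (l : K) : hermBorder M v d *ᵥ Sum.elim x (fun _ => l) =
      Sum.elim (M *ᵥ x + l • v) (fun _ => star v ⬝ᵥ x + d * l) := by
    rw [hermBorder, fromBlocks_mulVec]
    ext (b | b)
    · simp [mulVec, dotProduct, mul_comm]
    · simp [mulVec, dotProduct]
  constructor
  · intro hdet x hx hMx hxv
    refine hdet (exists_mulVec_eq_zero_iff.1 ⟨Sum.elim x (fun _ => 0), ?_, ?_⟩)
    · intro h
      exact hx (funext fun b => congrFun h (Sum.inl b))
    · rw [hmul, hMx]
      have : star v ⬝ᵥ x = 0 := by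
        rw [← star_star x, star_dotProduct_star, star_eq_zero, hxv]
      ext (b | b) <;> simp [this]
  · intro h hdet
    obtain ⟨z, hz0, hz⟩ := exists_mulVec_eq_zero_iff.2 hdet
    obtain ⟨k, hk0, hk⟩ := exists_mulVec_eq_zero_iff.2 h0
    obtain ⟨x, l, rfl⟩ : ∃ x l, z = Sum.elim x (fun _ => l) :=
      ⟨fun b => z (Sum.inl b), z (Sum.inr ()), by ext (b | b) <;> rfl⟩
    rw [hmul] at hz
    have hz1 : M *ᵥ x + l • v = 0 := funext fun b => congrFun hz (Sum.inl b)
    have hz2 : star v ⬝ᵥ x + d * l = 0 := congrFun hz (Sum.inr ())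
    -- Pairing the upper part of the kernel equation with `star k` leaves `l * (star k ⬝ᵥ v) = 0`,
    -- hence `l = 0`.
    have hkM : star k ᵥ* M = 0 := by
      rw [← star_star (star k ᵥ* M), star_vecMul, star_star, hM.eq, hk, star_zero]
    have hl : l = 0 := by
      have := congrArg (fun w => star k ⬝ᵥ w) hz1
      simp only [dotProduct_add, dotProduct_mulVec, hkM, zero_dotProduct, zero_add,
        dotProduct_smul, dotProduct_zero, smul_eq_mul] at this
      exact (mul_eq_zero.1 this).resolve_right (h k hk0 hk)
    subst hl
    rw [zero_smul, add_zero] at hz1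
    rw [mul_zero, add_zero] at hz2
    refine h x ?_ hz1 ?_
    · rintro rfl
      exact hz0 (by ext (b | b) <;> rfl)
    · rw [← star_star v, star_dotProduct_star, star_eq_zero, hz2]

theorem natCard_linearMap_ne_zero {K : Type*} [Field K] [Finite K] {Z : Type*}
    [AddCommGroup Z] [Module K Z] [Finite Z]
    {q : ℕ} (hq : Nat.card K = q ^ 2) {g : Z →ₗ[K] K} (hg : g ≠ 0) :
    (Nat.card {z // g z ≠ 0} : ℚ) = (1 - 1 / (q : ℚ) ^ 2) * Nat.card Z := by
  classical
  have hq2 := two_le_of_natCard hq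
  have h1 := g.toAddMonoidHom.ker.card_mul_index
  rw [AddSubgroup.index_ker] at h1
  have h2 : Nat.card g.toAddMonoidHom.range = q ^ 2 := by
    rw [← hq]
    have : g.toAddMonoidHom.range = ⊤ :=
      AddMonoidHom.range_eq_top.2 (LinearMap.surjective hg)
    rw [this]
    exact Nat.card_congr (Equiv.Set.univ K)
  have h3 : Nat.card Z = Nat.card {z // g z = 0} + Nat.card {z // g z ≠ 0} := by
    rw [← Nat.card_sum]
    exact Nat.card_congr (Equiv.sumCompl _).symm
  have h4 : Nat.card g.toAddMonoidHom.ker = Nat.card {z // g z = 0} := rfl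
  rw [h2, h4] at h1
  rw [h3] at h1 ⊢
  have h1' := congrArg (Nat.cast : ℕ → ℚ) h1
  push_cast at h1' ⊢
  have hq0 : (q : ℚ) ≠ 0 := by positivity
  field_simp
  linear_combination -h1'

/-- For a singular hermitian matrix `M` the proportion of the vectors `v` in a linear family for
which bordering by `v` gives a non-singular matrix does not depend on the family. -/
theorem exists_border_density.{u} {K : Type u} [Field K] [StarRing K] [Finite K] {q : ℕ}
    (hq : Nat.card K = q ^ 2) {M : Matrix β β K} (h0 : M.det = 0) :
    ∃ ρ : ℚ, ∀ (Z : Type u) [AddCommGroup Z] [Module K Z] [Finite Z] (L : Z →ₗ[K] (β → K)),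
      (∀ x, x ≠ 0 → M *ᵥ x = 0 → ∃ z, star x ⬝ᵥ L z ≠ 0) →
      (Nat.card {z // ∀ x, x ≠ 0 → M *ᵥ x = 0 → star x ⬝ᵥ L z ≠ 0} : ℚ) = ρ * Nat.card Z := by
  obtain ⟨k, hk0, hk⟩ := exists_mulVec_eq_zero_iff.2 h0
  by_cases hdim : ∀ x, M *ᵥ x = 0 → ∃ c : K, x = c • k
  -- With a one-dimensional kernel the condition is that a non-zero linear functional on `Z` does
  -- not vanish.
  · refine ⟨1 - 1 / (q : ℚ) ^ 2, fun Z _ _ _ L hL => ?_⟩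
    let g : Z →ₗ[K] K :=
      { toFun := fun z => star k ⬝ᵥ L z
        map_add' := fun z w => by rw [map_add, dotProduct_add]
        map_smul' := fun c z => by rw [map_smul, dotProduct_smul, RingHom.id_apply] }
    have hg : g ≠ 0 := by
      obtain ⟨z, hz⟩ := hL k hk0 hk
      exact fun h => hz (LinearMap.congr_fun h z)
    rw [← natCard_linearMap_ne_zero hq hg]
    congr 1
    refine Nat.card_congr (Equiv.subtypeEquivRight fun z => ⟨fun h => h k hk0 hk, ?_⟩)
    intro h x hx0 hx
    obtain ⟨c, rfl⟩ := hdim x hx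
    rw [star_smul, smul_dotProduct, smul_eq_mul]
    refine mul_ne_zero (star_ne_zero.2 ?_) h
    rintro rfl
    exact hx0 (zero_smul _ _)
  -- With a larger kernel, every column is orthogonal to some non-zero kernel vector: `c` below is
  -- chosen to make `y - c • k` such a vector.
  · push Not at hdim
    obtain ⟨y, hy, hyk⟩ := hdim
    refine ⟨0, fun Z _ _ _ L hL => ?_⟩
    rw [zero_mul, Nat.cast_eq_zero, Nat.card_eq_zero]
    left
    refine ⟨fun ⟨z, hz⟩ => ?_⟩
    have hkz := hz k hk0 hk
    let c : K := star (star y ⬝ᵥ L z / (star k ⬝ᵥ L z))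
    refine hz (y - c • k) (sub_ne_zero.2 (hyk c)) ?_ ?_
    · rw [mulVec_sub, mulVec_smul, hk, hy, smul_zero, sub_zero]
    · rw [star_sub, star_smul, star_star, sub_dotProduct, smul_dotProduct, smul_eq_mul,
        div_mul_cancel₀ _ hkz, sub_self]

end Border

/-! ### The matrices to be counted, and the two ways of enlarging them. -/

section Completion

open Matrix

variable {K : Type*} [Field K] [StarRing K] {α ι ν : Type} [DecidableEq α] [Fintype ν]

/-- The hermitian matrix with upper left block `1 + Y * Yᴴ` and remaining blocks `C`, `Cᴴ`, `D`. -/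
def hermCompletion (Y : Matrix α ν K) (C : Matrix α ι K) (D : Matrix ι ι K) :
    Matrix (α ⊕ ι) (α ⊕ ι) K :=
  fromBlocks (1 + Y * Yᴴ) C Cᴴ D

theorem isHermitian_hermCompletion (Y : Matrix α ν K) (C : Matrix α ι K)
    (D : selfAdjoint (Matrix ι ι K)) : (hermCompletion Y C D).IsHermitian := by
  refine IsHermitian.fromBlocks ?_ rfl D.2
  exact isHermitian_one.add (isHermitian_mul_conjTranspose_self Y)

variable [Fintype α] [Fintype ι] [DecidableEq ι]

/-- The number of triples `(Y, C, D)` for which `hermCompletion Y C D` is non-singular. -/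
noncomputable def hermCompletionCard (K : Type*) [Field K] [StarRing K] (α ι ν : Type) [Fintype α]
    [DecidableEq α] [Fintype ι] [DecidableEq ι] [Fintype ν] : ℕ :=
  Nat.card {p : Matrix α ν K × Matrix α ι K × selfAdjoint (Matrix ι ι K) //
    (hermCompletion p.1 p.2.1 (p.2.2 : Matrix ι ι K)).det ≠ 0}

/-- Adding a row to a matrix. -/
def matrixSumUnitEquiv (R α ν : Type*) : Matrix (α ⊕ Unit) ν R ≃ Matrix α ν R × (ν → R) where
  toFun Y := (of fun a n => Y (Sum.inl a) n, fun n => Y (Sum.inr ()) n)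
  invFun p := of (Sum.elim p.1 fun _ => p.2)
  left_inv Y := by ext (a | a) n <;> rfl
  right_inv p := rfl

@[simp]
theorem matrixSumUnitEquiv_symm_inl {R α ν : Type*} (p : Matrix α ν R × (ν → R)) (a : α) (n : ν) :
    (matrixSumUnitEquiv R α ν).symm p (Sum.inl a) n = p.1 a n := rfl

@[simp]
theorem matrixSumUnitEquiv_symm_inr {R α ν : Type*} (p : Matrix α ν R × (ν → R)) (u : Unit)
    (n : ν) : (matrixSumUnitEquiv R α ν).symm p (Sum.inr u) n = p.2 n := rfl

/-- Exchange the last two summands of a sum of types. -/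
def sumUnitRotate (α ι : Type) : (α ⊕ ι) ⊕ Unit ≃ (α ⊕ Unit) ⊕ ι where
  toFun := Sum.elim (Sum.elim (fun a => Sum.inl (Sum.inl a)) Sum.inr) fun u => Sum.inl (Sum.inr u)
  invFun := Sum.elim (Sum.elim (fun a => Sum.inl (Sum.inl a)) Sum.inr) fun c => Sum.inl (Sum.inr c)
  left_inv := by rintro ((a | c) | u) <;> rfl
  right_inv := by rintro ((a | u) | c) <;> rfl

/-- The new rows are conjugated so that the bordering column is linear, not semilinear, in `(y, u)`.
-/
theorem det_hermCompletion_row (Y : Matrix α ν K) (C : Matrix α ι K) (D : Matrix ι ι K)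
    (y : ν → K) (u : ι → K) :
    (hermCompletion ((matrixSumUnitEquiv K α ν).symm (Y, star y))
      ((matrixSumUnitEquiv K α ι).symm (C, star u)) D).det =
    (hermBorder (hermCompletion Y C D) (Sum.elim (Y *ᵥ y) u) (1 + star y ⬝ᵥ y)).det := by
  rw [← det_submatrix_equiv_self (sumUnitRotate α ι)]
  refine congrArg det ?_
  ext ((a | c) | u) ((a' | c') | u') <;>
    simp only [submatrix_apply, hermBorder, hermCompletion, sumUnitRotate, Equiv.coe_fn_mk,
      Sum.elim_inl, Sum.elim_inr, fromBlocks_apply₁₁, fromBlocks_apply₁₂, fromBlocks_apply₂₁,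
      fromBlocks_apply₂₂, of_apply, Matrix.add_apply, mul_apply, conjTranspose_apply, one_apply,
      matrixSumUnitEquiv_symm_inl, matrixSumUnitEquiv_symm_inr, mulVec, dotProduct, Pi.star_apply,
      star_star, Sum.inl.injEq, reduceCtorEq, if_false, if_true, zero_add, star_sum, star_mul']
  exact Finset.sum_congr rfl fun _ _ => mul_comm _ _

theorem hermCompletionCard_sum_left :
    hermCompletionCard K (α ⊕ Unit) ι ν = Nat.card {s : (Matrix α ν K × Matrix α ι K ×
      selfAdjoint (Matrix ι ι K)) × ((ν → K) × (ι → K)) //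
      (hermBorder (hermCompletion s.1.1 s.1.2.1 (s.1.2.2 : Matrix ι ι K))
        (Sum.elim (s.1.1 *ᵥ s.2.1) s.2.2) (1 + star s.2.1 ⬝ᵥ s.2.1)).det ≠ 0} := by
  let E : (Matrix α ν K × Matrix α ι K × selfAdjoint (Matrix ι ι K)) × ((ν → K) × (ι → K)) ≃
      Matrix (α ⊕ Unit) ν K × Matrix (α ⊕ Unit) ι K × selfAdjoint (Matrix ι ι K) :=
    { toFun := fun s => ((matrixSumUnitEquiv K α ν).symm (s.1.1, star s.2.1),
        (matrixSumUnitEquiv K α ι).symm (s.1.2.1, star s.2.2), s.1.2.2)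
      invFun := fun p => (((matrixSumUnitEquiv K α ν p.1).1, (matrixSumUnitEquiv K α ι p.2.1).1,
        p.2.2), star (matrixSumUnitEquiv K α ν p.1).2, star (matrixSumUnitEquiv K α ι p.2.1).2)
      left_inv := fun s => by simp
      right_inv := fun p => by simp }
  refine (Nat.card_congr (E.subtypeEquiv fun s => ?_)).symm
  rw [← det_hermCompletion_row]
  rfl

/-- A self-adjoint matrix as a bordered self-adjoint matrix. -/
def selfAdjointBorderEquiv (K : Type*) [Field K] [StarRing K] (ι : Type) :
    selfAdjoint (Matrix ι ι K) × (ι → K) × selfAdjoint K ≃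
      selfAdjoint (Matrix (ι ⊕ Unit) (ι ⊕ Unit) K) where
  toFun s := ⟨hermBorder s.1 s.2.1 s.2.2,
    IsHermitian.fromBlocks s.1.2 rfl (by ext; exact s.2.2.2)⟩
  invFun p := (⟨of fun c c' => p.1 (Sum.inl c) (Sum.inl c'), by
      ext c c'; exact IsHermitian.apply p.2 _ _⟩,
    fun c => p.1 (Sum.inl c) (Sum.inr ()),
    ⟨p.1 (Sum.inr ()) (Sum.inr ()), IsHermitian.apply p.2 _ _⟩)
  left_inv s := rfl
  right_inv p := by
    ext (c | u) (c' | u')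
    · rfl
    · rfl
    · exact IsHermitian.apply p.2 _ _
    · rfl

theorem det_hermCompletion_column (Y : Matrix α ν K) (C : Matrix α ι K)
    (D : selfAdjoint (Matrix ι ι K)) (w : α → K) (u : ι → K) (d : selfAdjoint K) :
    (hermCompletion Y ((matrixSumUnitEquiv K ι α).symm (Cᵀ, w))ᵀ
      (selfAdjointBorderEquiv K ι (D, u, d) : Matrix (ι ⊕ Unit) (ι ⊕ Unit) K)).det =
    (hermBorder (hermCompletion Y C (D : Matrix ι ι K)) (Sum.elim w u) (d : K)).det := by
  rw [← det_submatrix_equiv_self (Equiv.sumAssoc α ι Unit)]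
  refine congrArg det ?_
  ext ((a | c) | u) ((a' | c') | u') <;>
    simp only [submatrix_apply, hermBorder, hermCompletion, selfAdjointBorderEquiv,
      Equiv.coe_fn_mk, Equiv.sumAssoc_apply_inl_inl, Equiv.sumAssoc_apply_inl_inr,
      Equiv.sumAssoc_apply_inr,
      Sum.elim_inl, Sum.elim_inr, fromBlocks_apply₁₁, fromBlocks_apply₁₂, fromBlocks_apply₂₁,
      fromBlocks_apply₂₂, of_apply, conjTranspose_apply, transpose_apply,
      matrixSumUnitEquiv_symm_inl, matrixSumUnitEquiv_symm_inr]

theorem hermCompletionCard_sum_right :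
    hermCompletionCard K α (ι ⊕ Unit) ν = Nat.card {s : (Matrix α ν K × Matrix α ι K ×
      selfAdjoint (Matrix ι ι K)) × ((α ⊕ ι → K) × selfAdjoint K) //
      (hermBorder (hermCompletion s.1.1 s.1.2.1 (s.1.2.2 : Matrix ι ι K)) s.2.1
        (s.2.2 : K)).det ≠ 0} := by
  let E : (Matrix α ν K × Matrix α ι K × selfAdjoint (Matrix ι ι K)) ×
      ((α ⊕ ι → K) × selfAdjoint K) ≃
      Matrix α ν K × Matrix α (ι ⊕ Unit) K × selfAdjoint (Matrix (ι ⊕ Unit) (ι ⊕ Unit) K) :=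
    { toFun := fun s => (s.1.1, ((matrixSumUnitEquiv K ι α).symm
          (s.1.2.1ᵀ, fun a => s.2.1 (Sum.inl a)))ᵀ,
        selfAdjointBorderEquiv K ι (s.1.2.2, fun c => s.2.1 (Sum.inr c), s.2.2))
      invFun := fun p => ((p.1, (matrixSumUnitEquiv K ι α p.2.1ᵀ).1ᵀ,
          ((selfAdjointBorderEquiv K ι).symm p.2.2).1),
        Sum.elim (matrixSumUnitEquiv K ι α p.2.1ᵀ).2
          ((selfAdjointBorderEquiv K ι).symm p.2.2).2.1,
        ((selfAdjointBorderEquiv K ι).symm p.2.2).2.2)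
      left_inv := fun s => by
        refine Prod.ext (by simp) (Prod.ext ?_ (by simp))
        ext (a | c) <;> simp
      right_inv := fun p => by simp }
  refine (Nat.card_congr (E.subtypeEquiv fun s => ?_)).symm
  rw [← Sum.elim_comp_inl_inr s.2.1, ← det_hermCompletion_column]
  rfl

theorem hermCompletionCard_congr {α' ι' : Type} [Fintype α'] [DecidableEq α'] [Fintype ι']
    [DecidableEq ι'] (e₁ : α ≃ α') (e₂ : ι ≃ ι') :
    hermCompletionCard K α ι ν = hermCompletionCard K α' ι' ν := by
  let E : Matrix α ν K × Matrix α ι K × selfAdjoint (Matrix ι ι K) ≃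
      Matrix α' ν K × Matrix α' ι' K × selfAdjoint (Matrix ι' ι' K) :=
    (reindex e₁ (Equiv.refl ν)).prodCongr ((reindex e₁ e₂).prodCongr
      ((reindex e₂ e₂).subtypeEquiv fun D => by
        change D.IsHermitian ↔ (D.submatrix _ _).IsHermitian
        rw [isHermitian_submatrix_equiv]))
  refine Nat.card_congr (E.subtypeEquiv fun s => ?_)
  rw [← det_submatrix_equiv_self (e₁.sumCongr e₂)]
  refine Iff.of_eq (congrArg (fun M => det M ≠ 0) ?_)
  ext (a | c) (a' | c') <;>
    simp [hermCompletion, E, mul_apply, one_apply]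

/-- The upper left block is the identity, and for fixed `C` the Schur complement `D - Cᴴ * C` runs
through all hermitian matrices. -/
theorem hermCompletionCard_of_isEmpty [IsEmpty ν] :
    hermCompletionCard K α ι ν = Nat.card (Matrix α ι K) *
      Nat.card {D : selfAdjoint (Matrix ι ι K) // (D : Matrix ι ι K).det ≠ 0} := by
  have hC (C : Matrix α ι K) : Cᴴ * C ∈ selfAdjoint (Matrix ι ι K) :=
    isHermitian_conjTranspose_mul_self C
  let E : Matrix α ν K × Matrix α ι K × selfAdjoint (Matrix ι ι K) ≃
      Matrix α ι K × selfAdjoint (Matrix ι ι K) :=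
    { toFun := fun p => (p.2.1, p.2.2 - ⟨_, hC p.2.1⟩)
      invFun := fun s => (0, s.1, s.2 + ⟨_, hC s.1⟩)
      left_inv := fun p => by
        refine Prod.ext (by ext a n; exact isEmptyElim n) (Prod.ext rfl ?_)
        exact sub_add_cancel _ _
      right_inv := fun s => by
        refine Prod.ext rfl ?_
        exact add_sub_cancel_right _ _ }
  rw [← Nat.card_prod]
  refine (Nat.card_congr (E.subtypeEquiv (q := fun s => (s.2 : Matrix ι ι K).det ≠ 0)
    fun p => ?_)).trans (Nat.card_congr
      { toFun := fun s => (s.1.1, ⟨s.1.2, s.2⟩)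
        invFun := fun s => ⟨(s.1, s.2.1), s.2.2⟩
        left_inv := fun _ => rfl
        right_inv := fun _ => rfl })
  have hY : p.1 * p.1ᴴ = 0 := by
    ext
    simp [mul_apply]
  rw [hermCompletion, hY, add_zero, det_fromBlocks_one₁₁]
  rfl

theorem hermCompletionCard_isEmpty_left [IsEmpty α] :
    hermCompletionCard K α ι ν =
      Nat.card {D : selfAdjoint (Matrix ι ι K) // (D : Matrix ι ι K).det ≠ 0} := by
  let E : Matrix α ν K × Matrix α ι K × selfAdjoint (Matrix ι ι K) ≃
      selfAdjoint (Matrix ι ι K) :=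
    { toFun := fun p => p.2.2
      invFun := fun D => (0, 0, D)
      left_inv := fun p => Prod.ext (Subsingleton.elim _ _) (Prod.ext (Subsingleton.elim _ _) rfl)
      right_inv := fun _ => rfl }
  refine Nat.card_congr (E.subtypeEquiv fun p => ?_)
  rw [← det_submatrix_equiv_self (Equiv.emptySum α ι).symm]
  rfl

end Completion

/-! ### Comparison of the two borderings, giving the recursion. -/

section Recursion

open Matrix

variable {K : Type*} [Field K] {α ι ν : Type} [Fintype ν]

theorem star_star_dotProduct {K : Type*} [Field K] [StarRing K] {β : Type} [Fintype β]
    (v w : β → K) :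
    star (star v ⬝ᵥ w) = star w ⬝ᵥ v :=
  (star_dotProduct w v).symm

/-- The linear part of a row that is added to `hermCompletion Y C D`. -/
def completionColumn (ι : Type) (Y : Matrix α ν K) : (ν → K) × (ι → K) →ₗ[K] (α ⊕ ι → K) where
  toFun z := Sum.elim (Y *ᵥ z.1) z.2
  map_add' z w := by
    ext (a | c)
    · simp [mulVec_add]
    · simp
  map_smul' c z := by
    ext (a | c)
    · simp [mulVec_smul]
    · simp

theorem completionColumn_apply (Y : Matrix α ν K) (z : (ν → K) × (ι → K)) :
    completionColumn ι Y z = Sum.elim (Y *ᵥ z.1) z.2 := rfl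

variable [StarRing K] [Fintype α] [Fintype ι]

theorem dotProduct_completionColumn (Y : Matrix α ν K) (x : α ⊕ ι → K) (z : (ν → K) × (ι → K)) :
    star x ⬝ᵥ completionColumn ι Y z =
      star (Yᴴ *ᵥ fun a => x (Sum.inl a)) ⬝ᵥ z.1 + star (fun c => x (Sum.inr c)) ⬝ᵥ z.2 := by
  rw [star_mulVec, conjTranspose_conjTranspose, ← dotProduct_mulVec]
  simp [dotProduct, completionColumn_apply]

variable [DecidableEq α]

theorem hermCompletion_mulVec (Y : Matrix α ν K) (C : Matrix α ι K) (D : Matrix ι ι K)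
    (x : α ⊕ ι → K) : hermCompletion Y C D *ᵥ x =
      Sum.elim ((fun a => x (Sum.inl a)) + Y *ᵥ (Yᴴ *ᵥ fun a => x (Sum.inl a)) +
        C *ᵥ fun c => x (Sum.inr c))
        (Cᴴ *ᵥ (fun a => x (Sum.inl a)) + D *ᵥ fun c => x (Sum.inr c)) := by
  rw [hermCompletion, fromBlocks_mulVec, add_mulVec, one_mulVec, mulVec_mulVec]
  rfl

/-- A kernel vector orthogonal to all columns has `Yᴴ x₁ = 0` and `x₂ = 0`, and then the identity in
the upper left block gives `x₁ = 0`. This is the hypothesis that `exists_border_density` asks for.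
-/
theorem exists_dotProduct_completionColumn_ne_zero (Y : Matrix α ν K) (C : Matrix α ι K)
    (D : Matrix ι ι K) (x : α ⊕ ι → K) (hx : x ≠ 0) (h : hermCompletion Y C D *ᵥ x = 0) :
    ∃ z, star x ⬝ᵥ completionColumn ι Y z ≠ 0 := by
  by_contra! hz
  simp only [dotProduct_completionColumn] at hz
  have h1 : star (Yᴴ *ᵥ fun a => x (Sum.inl a)) = 0 :=
    dotProduct_eq_zero _ fun y => by simpa using hz (y, 0)
  have h2 : star (fun c => x (Sum.inr c)) = 0 :=
    dotProduct_eq_zero _ fun u => by simpa using hz (0, u)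
  rw [star_eq_zero] at h1 h2
  rw [hermCompletion_mulVec, h1, h2, mulVec_zero, mulVec_zero, add_zero, add_zero] at h
  apply hx
  ext (a | c)
  · exact congrFun h (Sum.inl a)
  · exact congrFun h2 c

variable [DecidableEq ι]

/-- The hermitian form whose values on the diagonal decide whether a row can be added. -/
noncomputable def completionForm (Y : Matrix α ν K) (M : Matrix (α ⊕ ι) (α ⊕ ι) K) :
    ((ν → K) × (ι → K)) →ₗ[K] ((ν → K) × (ι → K)) →ₗ⋆[K] K :=
  LinearMap.mk₂'ₛₗ (RingHom.id K) (starRingEnd K)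
    (fun z z' => star z'.1 ⬝ᵥ z.1 -
      star (completionColumn ι Y z') ⬝ᵥ M⁻¹ *ᵥ completionColumn ι Y z)
    (fun z w z' => by
      rw [map_add, mulVec_add, dotProduct_add, Prod.fst_add, dotProduct_add]; ring)
    (fun c z z' => by
      rw [map_smul, mulVec_smul, dotProduct_smul, Prod.smul_fst, dotProduct_smul, ← smul_sub]; rfl)
    (fun z z' w => by
      rw [map_add, star_add, add_dotProduct, Prod.fst_add, star_add, add_dotProduct]; ring)
    (fun c z z' => by
      rw [map_smul, star_smul, smul_dotProduct, Prod.smul_fst, star_smul, smul_dotProduct,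
        ← smul_sub]; rfl)

theorem completionForm_apply (Y : Matrix α ν K) (M : Matrix (α ⊕ ι) (α ⊕ ι) K)
    (z z' : (ν → K) × (ι → K)) : completionForm Y M z z' = star z'.1 ⬝ᵥ z.1 -
      star (completionColumn ι Y z') ⬝ᵥ M⁻¹ *ᵥ completionColumn ι Y z := rfl

theorem isHermitianForm_completionForm (hs : ∃ x : K, star x ≠ x) (Y : Matrix α ν K)
    {M : Matrix (α ⊕ ι) (α ⊕ ι) K} (hM : M.IsHermitian) :
    IsHermitianForm (completionForm Y M) where
  involutive := star_star
  ne_id h := by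
    obtain ⟨x, hx⟩ := hs
    exact hx (RingHom.congr_fun h x)
  symm v w := by
    rw [starRingEnd_apply, completionForm_apply, completionForm_apply, star_sub]
    congr 1
    · rw [star_star_dotProduct]
    · rw [star_star_dotProduct, star_mulVec, hM.inv.eq, ← dotProduct_mulVec]

/-- For `z` in the radical, put `g = M⁻¹ (Y z₁, z₂)`. Orthogonality gives `z₁ = Yᴴ g₁` and `g₂ = 0`;
the first block of `M g` then reads `g₁ + Y z₁ = Y z₁`, so `g`, and with it `z`, vanishes. -/
theorem isNondegenerateForm_completionForm (Y : Matrix α ν K) (C : Matrix α ι K)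
    (D : Matrix ι ι K) (hM : (hermCompletion Y C D).det ≠ 0) :
    IsNondegenerateForm (completionForm Y (hermCompletion Y C D)) := by
  rw [IsNondegenerateForm, eq_bot_iff]
  intro z hz
  rw [mem_formRadical] at hz
  rw [Submodule.mem_bot]
  obtain ⟨g, hg⟩ : ∃ g, g = (hermCompletion Y C D)⁻¹ *ᵥ completionColumn ι Y z := ⟨_, rfl⟩
  have hMg : hermCompletion Y C D *ᵥ g = completionColumn ι Y z := by
    rw [hg, mulVec_mulVec, mul_nonsing_inv _ (isUnit_iff_ne_zero.2 hM), one_mulVec]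
  simp only [completionForm_apply, ← hg] at hz
  have hz' (w : (ν → K) × (ι → K)) : star (z.1 - Yᴴ *ᵥ fun a => g (Sum.inl a)) ⬝ᵥ w.1 -
      star (fun c => g (Sum.inr c)) ⬝ᵥ w.2 = 0 := by
    have h1 := congrArg star (hz w)
    rw [star_sub, star_star_dotProduct, star_star_dotProduct, star_zero,
      dotProduct_completionColumn] at h1
    rw [star_sub, sub_dotProduct]
    linear_combination h1
  have h1 : z.1 - Yᴴ *ᵥ (fun a => g (Sum.inl a)) = 0 :=
    star_eq_zero.1 (dotProduct_eq_zero _ fun y => by simpa using hz' (y, 0))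
  have h2 : (fun c => g (Sum.inr c)) = 0 :=
    star_eq_zero.1 (dotProduct_eq_zero _ fun u => by simpa using hz' (0, u))
  rw [sub_eq_zero] at h1
  rw [hermCompletion_mulVec, h2, mulVec_zero, mulVec_zero, add_zero, add_zero, ← h1,
    completionColumn_apply] at hMg
  have h3 : (fun a => g (Sum.inl a)) = 0 := by
    ext a
    simpa using congrFun hMg (Sum.inl a)
  rw [h3, mulVec_zero] at h1 hMg
  refine Prod.ext h1 ?_
  ext c
  simpa using (congrFun hMg (Sum.inr c)).symm

theorem natCard_free_border_of_det_eq_zero {β : Type} [Fintype β] [DecidableEq β]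
    (hs : ∃ x : K, star x ≠ x) {q : ℕ} (hq : Nat.card K = q ^ 2) {M : Matrix β β K}
    (hM : M.IsHermitian) (h0 : M.det = 0) :
    Nat.card {z : (β → K) × selfAdjoint K // (hermBorder M z.1 (z.2 : K)).det ≠ 0} =
      Nat.card {v : β → K // ∀ x, x ≠ 0 → M *ᵥ x = 0 → star x ⬝ᵥ v ≠ 0} * q := by
  rw [← natCard_selfAdjoint hs hq, ← Nat.card_prod]
  exact Nat.card_congr
    { toFun := fun z =>
        (⟨z.1.1, (det_hermBorder_ne_zero_of_det_eq_zero hM h0 _ _).1 z.2⟩, z.1.2)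
      invFun := fun z => ⟨(z.1.1, z.2), (det_hermBorder_ne_zero_of_det_eq_zero hM h0 _ _).2 z.1.2⟩
      left_inv := fun _ => rfl
      right_inv := fun _ => rfl }

theorem natCard_border_of_det_eq_zero {β : Type} [Fintype β] [DecidableEq β] {M : Matrix β β K}
    (hM : M.IsHermitian) (h0 : M.det = 0) {Z : Type*} (v : Z → β → K) (d : Z → K) :
    Nat.card {z // (hermBorder M (v z) (d z)).det ≠ 0} =
      Nat.card {z // ∀ x, x ≠ 0 → M *ᵥ x = 0 → star x ⬝ᵥ v z ≠ 0} :=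
  Nat.card_congr (Equiv.subtypeEquivRight fun z =>
    det_hermBorder_ne_zero_of_det_eq_zero hM h0 (v z) (d z))

variable [Finite K]

/-- By the Schur complement the border is singular exactly on the sphere where `completionForm`
takes the value `-1`, and this is subtracted from all `q ^ (2 * r)` choices. -/
theorem natCard_border_of_det_ne_zero (hs : ∃ x : K, star x ≠ x) {q : ℕ}
    (hq : Nat.card K = q ^ 2) (Y : Matrix α ν K) (C : Matrix α ι K)
    (D : selfAdjoint (Matrix ι ι K)) (hM : (hermCompletion Y C (D : Matrix ι ι K)).det ≠ 0)
    {r : ℕ} (hr : r = Fintype.card ν + Fintype.card ι) :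
    (Nat.card {z : (ν → K) × (ι → K) // (hermBorder (hermCompletion Y C (D : Matrix ι ι K))
      (Sum.elim (Y *ᵥ z.1) z.2) (1 + star z.1 ⬝ᵥ z.1)).det ≠ 0} : ℚ) =
      q ^ (2 * r) - (q : ℚ)⁻¹ * q ^ r * (q ^ r - (-1) ^ r) := by
  have hherm := isHermitianForm_completionForm hs Y (isHermitian_hermCompletion Y C D)
  have h1 := hherm.natCard_apply_self_eq (isNondegenerateForm_completionForm Y C D hM) (-1)
  have hfr : Module.finrank K ((ν → K) × (ι → K)) = r := by simp [hr]
  have h2 := sphereCard_eq_of_ne_zero hs hq r (s := -1) (by simp) (by simp)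
  rw [hfr] at h1
  rw [← h2, ← h1, eq_sub_iff_add_eq]
  have h3 : Nat.card ((ν → K) × (ι → K)) = q ^ (2 * r) := by
    rw [Nat.card_prod, Nat.card_fun, Nat.card_fun, hq, Nat.card_eq_fintype_card,
      Nat.card_eq_fintype_card, hr]
    ring
  rw [← Nat.cast_add, ← Nat.cast_pow, ← h3, ← Nat.card_sum]
  congr 1
  classical
  refine (Nat.card_congr (Equiv.sumCongr (Equiv.subtypeEquivRight fun z => ?_)
    (Equiv.refl _))).trans
    (Nat.card_congr ((Equiv.sumComm _ _).trans (Equiv.sumCompl _)))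
  rw [det_hermBorder_ne_zero_of_det_ne_zero hM, ← completionColumn_apply, completionForm_apply,
    not_iff_not]
  constructor <;> intro h <;> linear_combination h

/-- For each column exactly one self-adjoint corner is forbidden. -/
theorem natCard_free_border_of_det_ne_zero {β : Type} [Fintype β] [DecidableEq β]
    (hs : ∃ x : K, star x ≠ x) {q : ℕ} (hq : Nat.card K = q ^ 2) {M : Matrix β β K}
    (hM : M.IsHermitian) (h0 : M.det ≠ 0) :
    (Nat.card {z : (β → K) × selfAdjoint K // (hermBorder M z.1 (z.2 : K)).det ≠ 0} : ℚ) =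
      q ^ (2 * Fintype.card β) * (q - 1) := by
  have := Fintype.ofFinite K
  classical
  rw [natCard_subtype_prod fun (v : β → K) (d : selfAdjoint K) =>
    (hermBorder M v (d : K)).det ≠ 0]
  have h1 (v : β → K) :
      Nat.card {d : selfAdjoint K // (hermBorder M v (d : K)).det ≠ 0} = q - 1 := by
    have hv : star v ⬝ᵥ M⁻¹ *ᵥ v ∈ selfAdjoint K := by
      rw [selfAdjoint.mem_iff, star_star_dotProduct, star_mulVec, hM.inv.eq,
        ← dotProduct_mulVec]
    obtain ⟨c, hc⟩ : ∃ c : selfAdjoint K, (c : K) = star v ⬝ᵥ M⁻¹ *ᵥ v := ⟨⟨_, hv⟩, rfl⟩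
    have h2 (d : selfAdjoint K) : (hermBorder M v (d : K)).det ≠ 0 ↔ d ≠ c := by
      rw [det_hermBorder_ne_zero_of_det_ne_zero h0, ← hc, ne_eq, ne_eq, Subtype.ext_iff]
    rw [Nat.card_congr (Equiv.subtypeEquivRight h2), ← natCard_selfAdjoint hs hq,
      ← Nat.card_congr (Equiv.optionSubtypeNe c), Finite.card_option, Nat.add_sub_cancel]
  have hq2 := two_le_of_natCard hq
  have hcard : Fintype.card (β → K) = q ^ (2 * Fintype.card β) := by
    rw [← Nat.card_eq_fintype_card, Nat.card_fun, hq, Nat.card_eq_fintype_card, pow_mul]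
  rw [Finset.sum_congr rfl fun v _ => h1 v, Finset.sum_const, Finset.card_univ, hcard, smul_eq_mul]
  push_cast [Nat.cast_sub (by omega : 1 ≤ q)]
  rfl

/-- The recursion for one fixed matrix. The weights are the sizes of the two families of borders, so
singular matrices cancel by equality of densities; a non-singular one leaves the oscillating term of
the sphere count. -/
theorem natCard_border_add (hs : ∃ x : K, star x ≠ x) {q : ℕ}
    (hq : Nat.card K = q ^ 2) (Y : Matrix α ν K) (C : Matrix α ι K)
    (D : selfAdjoint (Matrix ι ι K)) {r b : ℕ} (hr : r = Fintype.card ν + Fintype.card ι)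
    (hb : b = Fintype.card α + Fintype.card ι)
    [Decidable ((hermCompletion Y C (D : Matrix ι ι K)).det ≠ 0)] :
    (q : ℚ) ^ (2 * b + 1) * (Nat.card {z : (ν → K) × (ι → K) //
      (hermBorder (hermCompletion Y C (D : Matrix ι ι K))
        (Sum.elim (Y *ᵥ z.1) z.2) (1 + star z.1 ⬝ᵥ z.1)).det ≠ 0} : ℚ) =
      q ^ (2 * r) * (Nat.card {z : (α ⊕ ι → K) × selfAdjoint K //
        (hermBorder (hermCompletion Y C (D : Matrix ι ι K)) z.1 (z.2 : K)).det ≠ 0} : ℚ) +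
      q ^ (2 * b + r) * (-1) ^ r *
        if (hermCompletion Y C (D : Matrix ι ι K)).det ≠ 0 then 1 else 0 := by
  have hherm := isHermitian_hermCompletion Y C D
  have hq2 := two_le_of_natCard hq
  have hq0 : (q : ℚ) ≠ 0 := by positivity
  have hcb : Fintype.card (α ⊕ ι) = b := by rw [Fintype.card_sum, hb]
  split_ifs with h0
  · rw [natCard_border_of_det_ne_zero hs hq Y C D h0 hr,
      natCard_free_border_of_det_ne_zero hs hq hherm h0, hcb]
    field_simp
    ring
  · rw [not_not] at h0
    obtain ⟨ρ, hρ⟩ := exists_border_density hq h0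
    have h1 := hρ _ (completionColumn ι Y) fun x hx h =>
      exists_dotProduct_completionColumn_ne_zero Y C D x hx h
    have h2 := hρ _ LinearMap.id fun x hx _ => by
      by_contra! h
      exact hx (star_eq_zero.1 (dotProduct_eq_zero _ h))
    have h3 : Nat.card ((ν → K) × (ι → K)) = q ^ (2 * r) := by
      rw [Nat.card_prod, Nat.card_fun, Nat.card_fun, hq, Nat.card_eq_fintype_card,
        Nat.card_eq_fintype_card, hr]
      ring
    have h4 : Nat.card (α ⊕ ι → K) = q ^ (2 * b) := by
      rw [Nat.card_fun, hq, Nat.card_eq_fintype_card, hcb, pow_mul]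
    have h6 := natCard_border_of_det_eq_zero hherm h0
      (fun z : (ν → K) × (ι → K) => Sum.elim (Y *ᵥ z.1) z.2) fun z => 1 + star z.1 ⬝ᵥ z.1
    simp only [LinearMap.id_apply, completionColumn_apply] at h1 h2
    rw [h6, natCard_free_border_of_det_eq_zero hs hq hherm h0, Nat.cast_mul, h1, h2, h3, h4]
    push_cast
    ring

theorem natCard_subtype_eq_sum {S : Type*} [Fintype S] (P : S → Prop) [DecidablePred P] :
    (Nat.card {s // P s} : ℚ) = ∑ s, if P s then 1 else 0 := by
  rw [Nat.card_eq_fintype_card, Fintype.card_subtype, Finset.sum_boole]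

theorem hermCompletionCard_recursion (hs : ∃ x : K, star x ≠ x) {q : ℕ}
    (hq : Nat.card K = q ^ 2) {r b : ℕ} (hr : r = Fintype.card ν + Fintype.card ι)
    (hb : b = Fintype.card α + Fintype.card ι) :
    (q : ℚ) ^ (2 * b + 1) * hermCompletionCard K (α ⊕ Unit) ι ν =
      q ^ (2 * r) * hermCompletionCard K α (ι ⊕ Unit) ν +
      q ^ (2 * b + r) * (-1) ^ r * hermCompletionCard K α ι ν := by
  classical
  have := Fintype.ofFinite K
  have := Fintype.ofFinite (Matrix α ν K × Matrix α ι K × selfAdjoint (Matrix ι ι K))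
  rw [hermCompletionCard_sum_left, hermCompletionCard_sum_right, hermCompletionCard,
    natCard_subtype_prod fun (s : Matrix α ν K × Matrix α ι K × selfAdjoint (Matrix ι ι K))
      (z : (ν → K) × (ι → K)) => (hermBorder (hermCompletion s.1 s.2.1 (s.2.2 : Matrix ι ι K))
        (Sum.elim (s.1 *ᵥ z.1) z.2) (1 + star z.1 ⬝ᵥ z.1)).det ≠ 0,
    natCard_subtype_prod fun (s : Matrix α ν K × Matrix α ι K × selfAdjoint (Matrix ι ι K))
      (z : (α ⊕ ι → K) × selfAdjoint K) =>
        (hermBorder (hermCompletion s.1 s.2.1 (s.2.2 : Matrix ι ι K)) z.1 (z.2 : K)).det ≠ 0,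
    natCard_subtype_eq_sum, Nat.cast_sum, Nat.cast_sum, Finset.mul_sum, Finset.mul_sum,
    Finset.mul_sum, ← Finset.sum_add_distrib]
  exact Finset.sum_congr rfl fun s _ => natCard_border_add hs hq s.1 s.2.1 s.2.2 hr hb

end Recursion

/-! ### Solution of the recursion. -/

section ClosedForm

open Matrix

theorem choose_two_add_choose_two (i : ℕ) : (i + 1).choose 2 + i.choose 2 = i ^ 2 := by
  induction i with
  | zero => rfl
  | succ i ih =>
    rw [Nat.choose_succ_succ' (i + 1), Nat.choose_one_right, Nat.choose_succ_succ' i,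
      Nat.choose_one_right] at *
    linarith

theorem phiPlus_succ {a b : ℕ} (h : a ≤ b + 1) (q : ℚ) :
    phiPlus a (b + 1) q = phiPlus a b q * (q ^ (b + 1) + (-1) ^ (b + 1)) := by
  rw [phiPlus, phiPlus, Finset.prod_Icc_succ_top h]

theorem phiMinus_succ {a b : ℕ} (h : a ≤ b + 1) (q : ℚ) :
    phiMinus a (b + 1) q = phiMinus a b q * (q ^ (b + 1) - (-1) ^ (b + 1)) := by
  rw [phiMinus, phiMinus, Finset.prod_Icc_succ_top h]

theorem phiMinus_one_ne_zero {q : ℚ} (hq : 1 < q) (b : ℕ) : phiMinus 1 b q ≠ 0 := by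
  rw [phiMinus, Finset.prod_ne_zero_iff]
  intro k hk
  have h1 : 1 < q ^ k := one_lt_pow₀ hq (by have := (Finset.mem_Icc.1 hk).1; omega)
  rcases neg_one_pow_eq_or ℚ k with h | h <;> rw [h] <;> intro h' <;> linarith

theorem phiMinus_one_mul {a b : ℕ} (h : a ≤ b) (q : ℚ) :
    phiMinus 1 a q * phiMinus (a + 1) b q = phiMinus 1 b q := by
  rw [phiMinus, phiMinus, phiMinus, ← Finset.prod_union]
  · congr 1
    ext k
    simp only [Finset.mem_union, Finset.mem_Icc]
    omega
  · rw [Finset.disjoint_left]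
    intro k hk
    simp only [Finset.mem_Icc] at hk ⊢
    omega

theorem phiPlus_one_mul {a b : ℕ} (h : a ≤ b) (q : ℚ) :
    phiPlus 1 a q * phiPlus (a + 1) b q = phiPlus 1 b q := by
  rw [phiPlus, phiPlus, phiPlus, ← Finset.prod_union]
  · congr 1
    ext k
    simp only [Finset.mem_union, Finset.mem_Icc]
    omega
  · rw [Finset.disjoint_left]
    intro k hk
    simp only [Finset.mem_Icc] at hk ⊢
    omega

theorem gaussMinus_mul {a b : ℕ} (h : a ≤ b) {q : ℚ} (hq : 1 < q) :
    gaussMinus b a q * phiMinus 1 a q * phiMinus 1 (b - a) q = phiMinus 1 b q := by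
  rw [gaussMinus, if_pos h, div_mul_cancel₀ _ (phiMinus_one_ne_zero hq a), mul_comm,
    phiMinus_one_mul (by omega)]

theorem gaussMinus_zero_right (b : ℕ) (q : ℚ) : gaussMinus b 0 q = 1 := by
  simp [gaussMinus, phiMinus]

theorem gaussMinus_of_lt {a b : ℕ} (h : b < a) (q : ℚ) : gaussMinus b a q = 0 := by
  rw [gaussMinus, if_neg (by omega)]

theorem gaussMinus_self (b : ℕ) {q : ℚ} (hq : 1 < q) : gaussMinus b b q = 1 := by
  have := gaussMinus_mul le_rfl hq (a := b)
  rw [Nat.sub_self, show phiMinus 1 0 q = 1 by simp [phiMinus], mul_one] at this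
  exact mul_right_cancel₀ (phiMinus_one_ne_zero hq b) (this.trans (one_mul _).symm)

/-- The Pascal rule for the modified Gaussian coefficients. -/
theorem gaussMinus_succ_succ {a m : ℕ} (h : m ≤ a) {q : ℚ} (hq : 1 < q) :
    gaussMinus (a + 1) (m + 1) q =
      (-1) ^ (m + 1) * gaussMinus a (m + 1) q + q ^ (a - m) * gaussMinus a m q := by
  rcases h.lt_or_eq with h | rfl
  · obtain ⟨d, rfl⟩ : ∃ d, a = m + 1 + d := ⟨a - (m + 1), by omega⟩
    have h1 := gaussMinus_mul (show m + 1 ≤ m + 1 + d + 1 by omega) hq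
    have h2 := gaussMinus_mul (show m + 1 ≤ m + 1 + d by omega) hq
    have h3 := gaussMinus_mul (show m ≤ m + 1 + d by omega) hq
    rw [show m + 1 + d + 1 - (m + 1) = d + 1 by omega, phiMinus_succ (by omega) q (b := d),
      phiMinus_succ (by omega) q (b := m + 1 + d), phiMinus_succ (by omega) q (b := m)] at h1
    rw [show m + 1 + d - (m + 1) = d by omega, phiMinus_succ (by omega) q (b := m)] at h2
    rw [show m + 1 + d - m = d + 1 by omega, phiMinus_succ (by omega) q (b := d)] at h3
    have hm := phiMinus_one_ne_zero hq (m + 1)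
    have hd := phiMinus_one_ne_zero hq (d + 1)
    rw [phiMinus_succ (by omega)] at hm hd
    rw [show m + 1 + d - m = d + 1 by omega]
    refine mul_right_cancel₀ (mul_ne_zero hm hd) ?_
    linear_combination h1 - (-1) ^ (m + 1) * (q ^ (d + 1) - (-1) ^ (d + 1)) * h2 -
      q ^ (d + 1) * (q ^ (m + 1) - (-1) ^ (m + 1)) * h3
  · rw [gaussMinus_self _ hq, gaussMinus_self _ hq, gaussMinus_of_lt (Nat.lt_succ_self _)]
    simp

/-- The sum in the closed form for `hermCompletionCard`. -/
def completionSum (q : ℚ) (a i N : ℕ) : ℚ :=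
  ∑ m ∈ Finset.range (a + 1), (-1) ^ (m * (N + i)) * phiPlus 1 (a + i - m) q * gaussMinus a m q *
    (q ^ m.choose 2 * (q ^ (m * N))⁻¹)

theorem completionSum_zero (q : ℚ) (i N : ℕ) : completionSum q 0 i N = phiPlus 1 i q := by
  simp [completionSum, gaussMinus_zero_right]

/-- This is the recursion of `hermCompletionCard` up to powers of `q`. The Pascal rule splits the
term `m + 1` on the left into the term `m + 1` of the first sum and the term `m` of the second. -/
theorem completionSum_succ {q : ℚ} (hq : 1 < q) (a i N : ℕ) :
    completionSum q (a + 1) i N = completionSum q a (i + 1) N +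
      (-1) ^ (N + i) * (q ^ a * (q ^ N)⁻¹) * completionSum q a i N := by
  have hq0 : q ≠ 0 := by positivity
  have h1 : completionSum q a (i + 1) N = ∑ m ∈ Finset.range (a + 2), (-1) ^ (m * (N + (i + 1))) *
      phiPlus 1 (a + (i + 1) - m) q * gaussMinus a m q * (q ^ m.choose 2 * (q ^ (m * N))⁻¹) := by
    rw [Finset.sum_range_succ, gaussMinus_of_lt (Nat.lt_succ_self a), mul_zero, zero_mul, add_zero]
    rfl
  rw [h1, completionSum, Finset.sum_range_succ', Finset.sum_range_succ' _ (a + 1), completionSum,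
    Finset.mul_sum]
  refine Eq.trans ?_ (add_right_comm _ _ _)
  rw [← Finset.sum_add_distrib]
  congr 1
  · refine Finset.sum_congr rfl fun m hm => ?_
    have hma : m ≤ a := by have := Finset.mem_range.1 hm; omega
    obtain ⟨d, rfl⟩ : ∃ d, a = m + d := ⟨a - m, by omega⟩
    rw [gaussMinus_succ_succ hma hq, Nat.choose_succ_succ', Nat.choose_one_right,
      show m + d + 1 + i - (m + 1) = m + d + i - m by omega,
      show m + d + (i + 1) - (m + 1) = m + d + i - m by omega, show m + d - m = d by omega,
      pow_add q m (m.choose 2), pow_add q m d, show (m + 1) * N = m * N + N by ring, pow_add q _ N]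
    have hs1 : (-1 : ℚ) ^ ((m + 1) * (N + (i + 1))) =
        (-1) ^ ((m + 1) * (N + i)) * (-1) ^ (m + 1) := pow_add _ _ _
    have hs2 : (-1 : ℚ) ^ ((m + 1) * (N + i)) = (-1) ^ (m * (N + i)) * (-1) ^ (N + i) := by
      rw [← pow_add]; congr 1; ring
    rw [hs1, hs2]
    field_simp
  · simp [gaussMinus_zero_right, show a + 1 + i = a + (i + 1) by ring]

variable {K : Type*} [Field K] [StarRing K] [Finite K]

theorem hermCompletionCard_fin_succ (hs : ∃ x : K, star x ≠ x) {q : ℕ} (hq : Nat.card K = q ^ 2)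
    (a i N : ℕ) :
    (q : ℚ) ^ (2 * (a + i) + 1) * hermCompletionCard K (Fin (a + 1)) (Fin i) (Fin N) =
      q ^ (2 * (N + i)) * hermCompletionCard K (Fin a) (Fin (i + 1)) (Fin N) +
      q ^ (2 * (a + i) + (N + i)) * (-1) ^ (N + i) *
        hermCompletionCard K (Fin a) (Fin i) (Fin N) := by
  have e (n : ℕ) : Fin (n + 1) ≃ Fin n ⊕ Unit := Fintype.equivOfCardEq (by simp)
  rw [hermCompletionCard_congr (e a) (Equiv.refl (Fin i)),
    hermCompletionCard_congr (Equiv.refl (Fin a)) (e i)]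
  exact hermCompletionCard_recursion hs hq (by simp) (by simp)

/-- The recursion with `α` and `ν` empty involves only counts of non-singular hermitian matrices,
because a block `1` can be cleared; this makes it a first-order recursion in the size. -/
theorem natCard_selfAdjoint_det_ne_zero (hs : ∃ x : K, star x ≠ x) {q : ℕ}
    (hq : Nat.card K = q ^ 2) (i : ℕ) :
    (Nat.card {D : selfAdjoint (Matrix (Fin i) (Fin i) K) // (D : Matrix (Fin i) (Fin i) K).det ≠ 0} :
      ℚ) =
      q ^ i.choose 2 * phiPlus 1 i q := by
  have hq2 := two_le_of_natCard hq
  have hq0 : (q : ℚ) ≠ 0 := by positivity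
  induction i with
  | zero =>
    have : Nat.card {D : selfAdjoint (Matrix (Fin 0) (Fin 0) K) //
        (D : Matrix (Fin 0) (Fin 0) K).det ≠ 0} = 1 := by
      rw [Nat.card_eq_one_iff_unique]
      exact ⟨⟨fun D E => Subtype.ext (Subtype.ext (Subsingleton.elim _ _))⟩, ⟨⟨0, by simp⟩⟩⟩
    rw [this]
    simp [phiPlus]
  | succ i ih =>
    have h := hermCompletionCard_fin_succ hs hq 0 i 0
    rw [hermCompletionCard_isEmpty_left (α := Fin 0), hermCompletionCard_isEmpty_left (α := Fin 0),
      hermCompletionCard_of_isEmpty, Nat.cast_mul, ih] at h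
    have h2 : Nat.card (Matrix (Fin (0 + 1)) (Fin i) K) = q ^ (2 * i) := by
      change Nat.card (Fin (0 + 1) → Fin i → K) = _
      rw [Nat.card_fun, Nat.card_fun, hq]
      simp [pow_mul]
    rw [h2] at h
    rw [phiPlus_succ (by omega), Nat.choose_succ_succ', Nat.choose_one_right]
    refine mul_left_cancel₀ (pow_ne_zero (2 * (0 + i)) hq0) ?_
    rw [zero_add] at h ⊢
    push_cast at h
    linear_combination -h

/-- Each step lowers `a` and may raise `i`, so `i` is generalised; the base case is the count of
non-singular hermitian matrices. -/
theorem hermCompletionCard_eq (hs : ∃ x : K, star x ≠ x) {q : ℕ} (hq : Nat.card K = q ^ 2)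
    (a i N : ℕ) :
    (q : ℚ) ^ (a + i + 1).choose 2 * hermCompletionCard K (Fin a) (Fin i) (Fin N) =
      q ^ (2 * a * N + 2 * a * i + i ^ 2) * completionSum q a i N := by
  have hq2 := two_le_of_natCard hq
  have hq0 : (q : ℚ) ≠ 0 := by positivity
  have hq1 : (1 : ℚ) < q := by exact_mod_cast hq2
  induction a generalizing i with
  | zero =>
    rw [hermCompletionCard_isEmpty_left, natCard_selfAdjoint_det_ne_zero hs hq, completionSum_zero,
      ← mul_assoc, ← pow_add]
    rw [← choose_two_add_choose_two i]
    congr 2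
    ring_nf
  | succ a ih =>
    have h := hermCompletionCard_fin_succ hs hq a i N
    have h1 := ih i
    have h2 := ih (i + 1)
    rw [completionSum_succ hq1]
    rw [show a + (i + 1) + 1 = (a + i + 1) + 1 by ring, Nat.choose_succ_succ', Nat.choose_one_right,
      pow_add] at h2
    rw [show a + 1 + i + 1 = (a + i + 1) + 1 by ring, Nat.choose_succ_succ', Nat.choose_one_right,
      pow_add]
    refine mul_left_cancel₀ (pow_ne_zero (2 * (a + i) + 1) hq0) ?_
    have e1 : (q : ℚ) ^ (2 * (a + i) + 1) * (q ^ (a + i + 1) * q ^ (a + i + 1).choose 2 *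
        hermCompletionCard K (Fin (a + 1)) (Fin i) (Fin N)) = q ^ (2 * (N + i)) *
        (q ^ (2 * a * N + 2 * a * (i + 1) + (i + 1) ^ 2) * completionSum q a (i + 1) N) +
        q ^ (2 * (a + i) + (N + i)) * (-1) ^ (N + i) * q ^ (a + i + 1) *
        (q ^ (2 * a * N + 2 * a * i + i ^ 2) * completionSum q a i N) := by
      linear_combination q ^ (a + i + 1) * q ^ (a + i + 1).choose 2 * h +
        q ^ (2 * (N + i)) * h2 + q ^ (2 * (a + i) + (N + i)) * (-1) ^ (N + i) * q ^ (a + i + 1) * h1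
    rw [e1]
    field_simp
    ring

end ClosedForm

/-! ### Orthogonal complements and dual families. -/

section Duality

open Matrix

variable {K : Type*} [Field K] [StarRing K] {V : Type*} [AddCommGroup V] [Module K V]
  {f : V →ₗ[K] V →ₗ⋆[K] K}

/-- The vectors that are orthogonal to `U`. -/
def formOrth (f : V →ₗ[K] V →ₗ⋆[K] K) (U : Submodule K V) : Submodule K V where
  carrier := {v | ∀ u ∈ U, f v u = 0}
  add_mem' hx hy u hu := by rw [map_add, LinearMap.add_apply, hx u hu, hy u hu, add_zero]
  zero_mem' u _ := by rw [map_zero, LinearMap.zero_apply]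
  smul_mem' c x hx u hu := by rw [sesq_smul_left, hx u hu, mul_zero]

theorem mem_formOrth_span {s : Set V} {v : V} :
    v ∈ formOrth f (Submodule.span K s) ↔ ∀ u ∈ s, f v u = 0 := by
  refine ⟨fun h u hu => h u (Submodule.subset_span hu), fun h u hu => ?_⟩
  induction hu using Submodule.span_induction with
  | mem u hu => exact h u hu
  | zero => exact map_zero _
  | add x y _ _ hx hy => rw [map_add, hx, hy, add_zero]
  | smul c x _ hx => rw [sesq_smul_right, hx, mul_zero]

/-- If the evaluation map were not onto, a functional `l` killing its range would give a combination
of the `p b` orthogonal to everything, hence a linear dependence. -/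
theorem IsHermitianForm.exists_apply_eq (hf : IsHermitianForm f) (hnd : IsNondegenerateForm f)
    {ι : Type*} [Fintype ι] {p : ι → V} (hp : LinearIndependent K p) (x : ι → K) :
    ∃ v, ∀ b, f v (p b) = x b := by
  classical
  let g : V →ₗ[K] (ι → K) := LinearMap.pi fun b => f.flip (p b)
  suffices h : LinearMap.range g = ⊤ by
    obtain ⟨v, hv⟩ := LinearMap.range_eq_top.1 h x
    exact ⟨v, fun b => congrFun hv b⟩
  by_contra hne
  obtain ⟨l, hl0, hl⟩ := Submodule.exists_le_ker_of_lt_top _ (lt_top_iff_ne_top.2 hne)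
  have h1 : ∑ b, star (l (Pi.single b 1)) • p b = 0 := by
    refine hnd.eq_zero fun w => ?_
    rw [hf.eq_zero_comm, map_sum]
    have h2 : l (g w) = 0 := hl ⟨w, rfl⟩
    rw [LinearMap.pi_apply_eq_sum_univ l (g w)] at h2
    rw [← h2]
    refine Finset.sum_congr rfl fun b _ => ?_
    rw [sesq_smul_right, star_star, smul_eq_mul, mul_comm]
    congr 2
    ext c
    simp [Pi.single_apply, eq_comm]
  rw [Fintype.linearIndependent_iff] at hp
  have h3 := hp _ h1
  apply hl0
  ext b
  simpa using h3 b

theorem IsHermitianForm.exists_apply_eq_functional [FiniteDimensional K V]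
    (hf : IsHermitianForm f) (hnd : IsNondegenerateForm f) (g : V →ₗ[K] K) :
    ∃ t, ∀ v, f v t = g v := by
  let b := Module.finBasis K V
  obtain ⟨t, ht⟩ := hf.exists_apply_eq hnd b.linearIndependent fun c => star (g (b c))
  refine ⟨t, fun v => ?_⟩
  have : f.flip t = g := b.ext fun c => by
    rw [LinearMap.flip_apply, ← hf.star_apply, ht, star_star]
  exact LinearMap.congr_fun this v

theorem IsHermitianForm.finrank_formOrth_span [FiniteDimensional K V] (hf : IsHermitianForm f)
    (hnd : IsNondegenerateForm f) {ι : Type*} [Fintype ι] {p : ι → V}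
    (hp : LinearIndependent K p) :
    Fintype.card ι + Module.finrank K (formOrth f (Submodule.span K (Set.range p))) =
      Module.finrank K V := by
  let g : V →ₗ[K] (ι → K) := LinearMap.pi fun b => f.flip (p b)
  have h1 : LinearMap.range g = ⊤ := by
    rw [LinearMap.range_eq_top]
    intro x
    obtain ⟨v, hv⟩ := hf.exists_apply_eq hnd hp x
    exact ⟨v, funext hv⟩
  have h2 : LinearMap.ker g = formOrth f (Submodule.span K (Set.range p)) := by
    ext v
    rw [LinearMap.mem_ker, mem_formOrth_span, Set.forall_mem_range, funext_iff]
    rfl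
  rw [← LinearMap.finrank_range_add_finrank_ker g, h1, h2, finrank_top, Module.finrank_pi]

theorem IsHermitianForm.finrank_formOrth [FiniteDimensional K V] (hf : IsHermitianForm f)
    (hnd : IsNondegenerateForm f) (U : Submodule K V) :
    Module.finrank K U + Module.finrank K (formOrth f U) = Module.finrank K V := by
  let b := Module.finBasis K U
  have h := hf.finrank_formOrth_span hnd (b.linearIndependent.map' U.subtype U.ker_subtype)
  have hspan : Submodule.span K (Set.range (U.subtype ∘ b)) = U := by
    rw [Set.range_comp, ← Submodule.map_span, b.span_eq, Submodule.map_top, Submodule.range_subtype]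
  rwa [hspan, Fintype.card_fin] at h

theorem IsHermitianForm.formOrth_formOrth [FiniteDimensional K V] (hf : IsHermitianForm f)
    (hnd : IsNondegenerateForm f) (U : Submodule K V) : formOrth f (formOrth f U) = U := by
  symm
  refine Submodule.eq_of_le_of_finrank_eq (fun u hu v hv => hf.eq_zero_comm.1 (hv u hu)) ?_
  have h1 := hf.finrank_formOrth hnd U
  have h2 := hf.finrank_formOrth hnd (formOrth f U)
  omega

theorem mem_formRadical_domRestrict {U : Submodule K V} {u : U} :
    u ∈ formRadical (f.domRestrict₁₂ U U) ↔ ∀ w ∈ U, f u w = 0 := by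
  rw [mem_formRadical]
  exact ⟨fun h w hw => h ⟨w, hw⟩, fun h w => h w w.2⟩

theorem isSingularSpace_zero_iff [FiniteDimensional K V] {d : ℕ} {U : Submodule K V} :
    IsSingularSpace f 0 d U ↔
      Module.finrank K U = d ∧ ∀ u ∈ U, (∀ w ∈ U, f u w = 0) → u = 0 := by
  rw [IsSingularSpace, Submodule.finrank_eq_zero, eq_bot_iff]
  refine and_congr_right fun _ => ⟨fun h u hu hw => ?_, fun h u hu => ?_⟩
  · have hm : (⟨u, hu⟩ : U) ∈ formRadical (f.domRestrict₁₂ U U) :=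
      mem_formRadical_domRestrict.2 hw
    have := h hm
    rw [Submodule.mem_bot] at this
    exact congrArg Subtype.val this
  · rw [Submodule.mem_bot]
    exact Subtype.ext (h u u.2 (mem_formRadical_domRestrict.1 hu))

/-- The Gram matrix of a family of vectors. -/
def formGram {ι : Type*} (f : V →ₗ[K] V →ₗ⋆[K] K) (t : ι → V) : Matrix ι ι K :=
  of fun a b => f (t a) (t b)

theorem sesq_sum_left {ι : Type*} [Fintype ι] (t : ι → V) (x : ι → K) (w : V) :
    f (∑ b, x b • t b) w = ∑ b, x b * f (t b) w := by
  rw [map_sum, LinearMap.sum_apply]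
  exact Finset.sum_congr rfl fun b _ => sesq_smul_left f _ _ _

theorem sesq_sum_right {ι : Type*} [Fintype ι] (t : ι → V) (x : ι → K) (w : V) :
    f w (∑ b, x b • t b) = ∑ b, star (x b) * f w (t b) := by
  rw [map_sum]
  exact Finset.sum_congr rfl fun b _ => sesq_smul_right f _ _ _

/-- If a space has dimension `k + dim π`, the complements of `π` that are non-singular
correspond to the families dual to a basis of `π` with a non-singular Gram matrix. -/
theorem IsHermitianForm.gammaCount_eq_natCard_dual [FiniteDimensional K V]
    (hf : IsHermitianForm f) (hnd : IsNondegenerateForm f) {ι : Type*} [Fintype ι]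
    [DecidableEq ι] {π : Submodule K V} (p : Module.Basis ι K π) {k : ℕ}
    (hk : Module.finrank K V = k + Module.finrank K π) :
    gammaCount f π k = Nat.card {t : ι → V //
      (∀ a b, f (t a) (p b : V) = if a = b then 1 else 0) ∧ (formGram f t).det ≠ 0} := by
  have hcard : Fintype.card ι = Module.finrank K π := (Module.finrank_eq_card_basis p).symm
  have hdual (t : ι → V) (ht : ∀ a b, f (t a) (p b : V) = if a = b then 1 else 0) (x : ι → K)
      (c : ι) : f (∑ b, x b • t b) (p c : V) = x c := by
    rw [sesq_sum_left]
    simp [ht]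
  have hli (t : ι → V) (ht : ∀ a b, f (t a) (p b : V) = if a = b then 1 else 0) :
      LinearIndependent K t := by
    rw [Fintype.linearIndependent_iff]
    intro x hx c
    rw [← hdual t ht x c, hx, map_zero, LinearMap.zero_apply]
  -- The complement `σ` is recovered from its dual family as the orthogonal space of the span.
  let Φ : (ι → V) → Submodule K V := fun t => formOrth f (Submodule.span K (Set.range t))
  have hmem (t : ι → V) (v : V) : v ∈ Φ t ↔ ∀ a, f v (t a) = 0 := by
    rw [mem_formOrth_span, Set.forall_mem_range]
  have hrank (t : ι → V) (ht : ∀ a b, f (t a) (p b : V) = if a = b then 1 else 0) :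
      Module.finrank K (Φ t) = k := by
    have := hf.finrank_formOrth_span hnd (hli t ht)
    change _ + Module.finrank K (Φ t) = _ at this
    omega
  have hrepr (v : V) (hv : v ∈ π) : v = ∑ b, p.repr ⟨v, hv⟩ b • (p b : V) := by
    have := congrArg π.subtype (p.sum_repr ⟨v, hv⟩)
    rw [map_sum] at this
    exact this.symm
  have hinf (t : ι → V) (ht : ∀ a b, f (t a) (p b : V) = if a = b then 1 else 0) :
      Φ t ⊓ π = ⊥ := by
    rw [eq_bot_iff]
    rintro v ⟨hv, hvπ⟩
    rw [SetLike.mem_coe, hmem] at hv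
    have h2 := hrepr v hvπ
    have h3 (a : ι) : p.repr ⟨v, hvπ⟩ a = 0 := by
      have h4 := hf.eq_zero_comm.1 (hv a)
      rw [h2, sesq_sum_right] at h4
      simpa [ht] using h4
    rw [Submodule.mem_bot, h2]
    simp [h3]
  have htop (σ : Submodule K V) (h1 : Module.finrank K σ = k) (h2 : σ ⊓ π = ⊥) : π ⊔ σ = ⊤ := by
    refine Submodule.eq_top_of_finrank_eq ?_
    have := Submodule.finrank_sup_add_finrank_inf_eq π σ
    rw [inf_comm, h2, finrank_bot] at this
    omega
  have hVns : ∀ v : V, (∀ w, f v w = 0) → v = 0 := fun v hv => hnd.eq_zero hv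
  -- The span of `t` and its orthogonal space `Φ t` have the same radical, their intersection; the
  -- Gram matrix detects it on the first, the condition on the right on the second.
  have hns (t : ι → V) (ht : ∀ a b, f (t a) (p b : V) = if a = b then 1 else 0) :
      (formGram f t).det ≠ 0 ↔ ∀ u ∈ Φ t, (∀ w ∈ Φ t, f u w = 0) → u = 0 := by
    constructor
    · intro hdet u hu hw
      refine hVns u fun v => ?_
      let c : ι → K := (fun b => f v (t b)) ᵥ* (formGram f t)⁻¹
      have hc : v - ∑ a, c a • t a ∈ Φ t := by
        rw [hmem]
        intro b
        have h1 : c ᵥ* formGram f t = fun b => f v (t b) := by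
          rw [vecMul_vecMul, nonsing_inv_mul _ (isUnit_iff_ne_zero.2 hdet), vecMul_one]
        rw [map_sub, LinearMap.sub_apply, sesq_sum_left, sub_eq_zero]
        exact (congrFun h1 b).symm
      have hv : v = (v - ∑ a, c a • t a) + ∑ a, c a • t a := by abel
      rw [hv, map_add, hw _ hc, zero_add, sesq_sum_right]
      exact Finset.sum_eq_zero fun a _ => by rw [(hmem t u).1 hu a, mul_zero]
    · intro h hdet
      obtain ⟨c, hc0, hc⟩ := exists_vecMul_eq_zero_iff.2 hdet
      have hu : ∑ a, c a • t a ∈ Φ t := by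
        rw [hmem]
        intro b
        rw [sesq_sum_left]
        exact congrFun hc b
      have h0 := h _ hu fun w hw => by
        rw [hf.eq_zero_comm, sesq_sum_right]
        exact Finset.sum_eq_zero fun a _ => by rw [(hmem t w).1 hw a, mul_zero]
      exact hc0 (funext fun b => Fintype.linearIndependent_iff.1 (hli t ht) c h0 b)
  have htopns : ∀ u ∈ (⊤ : Submodule K V), (∀ w ∈ (⊤ : Submodule K V), f u w = 0) → u = 0 :=
    fun u _ hw => hVns u fun w => hw w trivial
  have hset (σ : Submodule K V) : (IsSingularSpace f 0 k σ ∧ σ ⊓ π = ⊥ ∧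
      IsSingularSpace f 0 (k + Module.finrank K π) (π ⊔ σ)) ↔
      (IsSingularSpace f 0 k σ ∧ σ ⊓ π = ⊥) := by
    rw [← and_assoc, and_iff_left_iff_imp]
    rintro ⟨h1, h2⟩
    rw [htop σ h1.1 h2, isSingularSpace_zero_iff, finrank_top]
    exact ⟨hk, htopns⟩
  rw [gammaCount, ← Nat.card_coe_set_eq]
  let Ψ : {t : ι → V // (∀ a b, f (t a) (p b : V) = if a = b then 1 else 0) ∧
      (formGram f t).det ≠ 0} → {σ : Submodule K V | IsSingularSpace f 0 k σ ∧ σ ⊓ π = ⊥ ∧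
      IsSingularSpace f 0 (k + Module.finrank K π) (π ⊔ σ)} := fun t =>
    ⟨Φ t.1, (hset _).2 ⟨isSingularSpace_zero_iff.2 ⟨hrank _ t.2.1, (hns _ t.2.1).1 t.2.2⟩,
      hinf _ t.2.1⟩⟩
  refine (Nat.card_eq_of_bijective Ψ ⟨?_, ?_⟩).symm
  · rintro ⟨t, ht, htd⟩ ⟨t', ht', htd'⟩ h
    have hΦ : Φ t = Φ t' := congrArg Subtype.val h
    -- The difference `t a - t' a` is orthogonal to `π` by duality and to `Φ t = Φ t'`, which
    -- together span `V`.
    refine Subtype.ext (funext fun a => sub_eq_zero.1 (hVns _ fun w => ?_))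
    have hw : w ∈ π ⊔ Φ t := by
      rw [htop _ (hrank t ht) (hinf t ht)]
      trivial
    rw [Submodule.mem_sup] at hw
    obtain ⟨u, hu, v, hv, rfl⟩ := hw
    have h1 : f (t a - t' a) v = 0 := by
      have hv' := hv
      rw [hΦ] at hv'
      rw [map_sub, LinearMap.sub_apply, hf.eq_zero_comm.1 ((hmem t v).1 hv a),
        hf.eq_zero_comm.1 ((hmem t' v).1 hv' a), sub_zero]
    have h2 : f (t a - t' a) u = 0 := by
      rw [hrepr u hu, sesq_sum_right]
      refine Finset.sum_eq_zero fun b _ => ?_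
      rw [map_sub, LinearMap.sub_apply, ht, ht', sub_self, mul_zero]
    rw [map_add, h1, h2, add_zero]
  · rintro ⟨σ, hσ⟩
    obtain ⟨hσ1, hσ2⟩ := (hset σ).1 hσ
    have hcompl : IsCompl π σ := IsCompl.of_eq (by rw [inf_comm, hσ2]) (htop σ hσ1.1 hσ2)
    -- The vector `t a` represents the `a`-th coordinate of the projection onto `π` along `σ`.
    choose t ht using fun a => hf.exists_apply_eq_functional hnd
      ((p.coord a).comp (π.projectionOnto σ hcompl))
    have ht1 : ∀ a b, f (t a) (p b : V) = if a = b then 1 else 0 := by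
      intro a b
      rw [← hf.star_apply, ht, LinearMap.comp_apply, Submodule.projectionOnto_apply_left,
        Module.Basis.coord_apply, Module.Basis.repr_self, Finsupp.single_apply]
      by_cases hab : a = b
      · rw [if_pos hab, if_pos hab.symm, star_one]
      · rw [if_neg hab, if_neg (Ne.symm hab), star_zero]
    have ht2 : σ = Φ t := by
      refine Submodule.eq_of_le_of_finrank_eq (fun v hv => ?_) (by rw [hrank t ht1, hσ1.1])
      rw [hmem]
      intro a
      rw [ht, LinearMap.comp_apply, (Submodule.projectionOnto_apply_eq_zero_iff hcompl).2 hv,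
        map_zero]
    refine ⟨⟨t, ht1, (hns t ht1).2 ?_⟩, Subtype.ext ht2.symm⟩
    rw [← ht2]
    exact (isSingularSpace_zero_iff.1 hσ1).2

end Duality

/-! ### Normal form of the hermitian form relative to `π`. -/

section Adapted

open Matrix

variable {K : Type*} [Field K] [StarRing K] {V : Type*} [AddCommGroup V] [Module K V]
  {f : V →ₗ[K] V →ₗ⋆[K] K}

theorem IsOrthonormalFor.linearIndependent_sumElim {α κ : Type*} [Fintype α] [DecidableEq α]
    [Fintype κ] {e : α → V} {u : κ → V} (he : IsOrthonormalFor f e)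
    (hu : LinearIndependent K u) (hue : ∀ c b, f (u c) (e b) = 0) :
    LinearIndependent K (Sum.elim e u) := by
  rw [Fintype.linearIndependent_iff] at hu ⊢
  intro x hx
  rw [Fintype.sum_sum_type] at hx
  simp only [Sum.elim_inl, Sum.elim_inr] at hx
  have h1 (b : α) : x (Sum.inl b) = 0 := by
    have h2 := congrArg (fun v => f v (e b)) hx
    simp only [map_add, LinearMap.add_apply, map_zero, LinearMap.zero_apply] at h2
    rw [he.apply_sum_left (fun b => x (Sum.inl b)), sesq_sum_left] at h2
    simpa [hue] using h2
  simp only [h1, zero_smul, Finset.sum_const_zero, zero_add] at hx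
  rintro (b | c)
  · exact h1 b
  · exact hu _ hx c

/-- A basis of `π` and vectors `w`, `h`, with respect to which the form is in normal form: `p` is
an orthonormal family together with a basis of the radical of `π`, the space orthogonal to `π` is
spanned by this radical and the orthonormal family `w`, and `h` is dual to the basis of the radical
and orthogonal to the other vectors. -/
structure AdaptedBasis (f : V →ₗ[K] V →ₗ⋆[K] K) (π : Submodule K V) (α ι ν : Type)
    [DecidableEq α] [DecidableEq ι] [DecidableEq ν] [Fintype ι] [Fintype ν] where
  p : Module.Basis (α ⊕ ι) K π
  w : ν → V
  h : ι → V
  orthonormal_p : IsOrthonormalFor f fun b => (p (Sum.inl b) : V)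
  radical_p : ∀ c, ∀ v ∈ π, f (p (Sum.inr c)) v = 0
  orthonormal_w : IsOrthonormalFor f w
  w_mem : ∀ n, w n ∈ formOrth f π
  exists_eq : ∀ v ∈ formOrth f π, ∃ (x : ι → K) (y : ν → K),
    v = ∑ c, x c • (p (Sum.inr c) : V) + ∑ n, y n • w n
  h_inl : ∀ c b, f (h c) (p (Sum.inl b)) = 0
  h_inr : ∀ c d, f (h c) (p (Sum.inr d)) = if c = d then 1 else 0
  h_w : ∀ c n, f (h c) (w n) = 0

theorem IsHermitianForm.exists_adaptedBasis [Finite K] [FiniteDimensional K V]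
    (hf : IsHermitianForm f) (hnd : IsNondegenerateForm f) {π : Submodule K V} {i j : ℕ}
    (hπ : IsSingularSpace f i j π) : ∃ a N : ℕ, a + i = j ∧ N + i + j = Module.finrank K V ∧
      Nonempty (AdaptedBasis f π (Fin a) (Fin i) (Fin N)) := by
  obtain ⟨hj, hi⟩ := hπ
  obtain ⟨a, e, he, her⟩ := (hf.domRestrict π).exists_isOrthonormalFor
  have haj := he.finrank_eq her
  rw [hj, hi, Fintype.card_fin] at haj
  let r := Module.finBasisOfFinrankEq K (formRadical (f.domRestrict₁₂ π π)) hi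
  have hr (c) (v : V) (hv : v ∈ π) : f ((r c : π) : V) v = 0 :=
    mem_formRadical_domRestrict.1 (r c).2 v hv
  have hli : LinearIndependent K (Sum.elim e fun c => (r c : π)) :=
    he.linearIndependent_sumElim (r.linearIndependent.map' (Submodule.subtype _)
      (Submodule.ker_subtype _)) fun c b => hr c _ (e b).2
  let p : Module.Basis (Fin a ⊕ Fin i) K π := basisOfLinearIndependentOfCardEqFinrank' _ hli
    (by rw [hj, haj, Fintype.card_sum, Fintype.card_fin, Fintype.card_fin])
  have hpl (b) : p (Sum.inl b) = e b := by simp [p]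
  have hpr (c) : p (Sum.inr c) = (r c : π) := by simp [p]
  obtain ⟨N, w, hw, hwr⟩ := (hf.domRestrict (formOrth f π)).exists_isOrthonormalFor
  have hw' : IsOrthonormalFor f fun n => (w n : V) := fun b c => hw b c
  have hrw (c n) : f ((r c : π) : V) (w n : V) = 0 :=
    hf.eq_zero_comm.1 ((w n).2 _ (r c : π).2)
  have hmem (c) : ((r c : π) : V) ∈ formOrth f π := hr c
  have hex : ∀ v ∈ formOrth f π, ∃ (x : Fin i → K) (y : Fin N → K),
      v = ∑ c, x c • (p (Sum.inr c) : V) + ∑ n, y n • (w n : V) := by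
    intro v hv
    have h1 := hwr ⟨v, hv⟩
    rw [mem_formRadical_domRestrict] at h1
    obtain ⟨u, hu⟩ : ∃ u : V, u = v - ∑ n, f v (w n : V) • (w n : V) := ⟨_, rfl⟩
    have hval : (((⟨v, hv⟩ : formOrth f π) - ∑ n, f.domRestrict₁₂ _ _ ⟨v, hv⟩ (w n) • w n :
        formOrth f π) : V) = u := by
      rw [hu, Submodule.coe_sub, Submodule.coe_sum]
      rfl
    rw [hval] at h1
    -- Removing the `w`-component leaves a vector `u` of `π^⊥` orthogonal to `π^⊥`, thus in `π^⊥⊥ =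
    -- π` and in the radical of `π`.
    have huπ : u ∈ π := by
      rw [← hf.formOrth_formOrth hnd π]
      exact h1
    have huo : u ∈ formOrth f π := by
      rw [hu]
      exact Submodule.sub_mem _ hv (Submodule.sum_mem _ fun n _ =>
        Submodule.smul_mem _ _ (w n).2)
    have hur : (⟨u, huπ⟩ : π) ∈ formRadical (f.domRestrict₁₂ π π) :=
      mem_formRadical_domRestrict.2 huo
    have h2 := congrArg (fun z : formRadical (f.domRestrict₁₂ π π) => ((z : π) : V))
      (r.sum_repr ⟨_, hur⟩)
    refine ⟨fun c => r.repr ⟨_, hur⟩ c, fun n => f v (w n : V), ?_⟩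
    have h3 : u = ∑ c, r.repr ⟨_, hur⟩ c • ((r c : π) : V) := by
      refine Eq.trans h2.symm ?_
      simp only [Submodule.coe_sum, Submodule.coe_smul]
    simp only [hpr]
    rw [← h3, hu]
    abel
  have hliw : LinearIndependent K (Sum.elim (fun n => (w n : V)) fun b => (p b : V)) := by
    refine hw'.linearIndependent_sumElim (p.linearIndependent.map' (Submodule.subtype _)
      (Submodule.ker_subtype _)) fun c b => hf.eq_zero_comm.1 ((w b).2 _ (p c).2)
  have hN : N + i = Module.finrank K (formOrth f π) := by
    have hli2 : LinearIndependent K (Sum.elim (fun n => (w n : V))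
        fun c => (p (Sum.inr c) : V)) := by
      have := hliw.comp (Sum.map id (Sum.inr : Fin i → Fin a ⊕ Fin i))
        (Function.Injective.sumMap Function.injective_id Sum.inr_injective)
      convert this using 1
      ext (n | c) <;> rfl
    have hspan : Submodule.span K (Set.range (Sum.elim (fun n => (w n : V))
        fun c => (p (Sum.inr c) : V))) = formOrth f π := by
      refine le_antisymm (Submodule.span_le.2 ?_) fun v hv => ?_
      · rintro _ ⟨(n | c), rfl⟩
        · exact (w n).2
        · rw [Sum.elim_inr, hpr]
          exact hmem c
      · obtain ⟨x, y, rfl⟩ := hex v hv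
        refine Submodule.add_mem _ (Submodule.sum_mem _ fun c _ => Submodule.smul_mem _ _
          (Submodule.subset_span ⟨Sum.inr c, rfl⟩)) (Submodule.sum_mem _ fun n _ =>
          Submodule.smul_mem _ _ (Submodule.subset_span ⟨Sum.inl n, rfl⟩))
    rw [← hspan, finrank_span_eq_card hli2, Fintype.card_sum, Fintype.card_fin, Fintype.card_fin]
  -- The families `w` and `p` are jointly independent, so the pairings of `h c` with all of them can
  -- be prescribed at once.
  choose h hh using fun c : Fin i => hf.exists_apply_eq hnd hliw
    (Pi.single (Sum.inr (Sum.inr c)) (1 : K))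
  refine ⟨a, N, haj.symm, ?_, ⟨⟨p, fun n => w n, h, ?_, ?_, hw', fun n => (w n).2, hex,
    fun c b => ?_, fun c d => ?_, fun c n => ?_⟩⟩⟩
  · have := hf.finrank_formOrth hnd π
    omega
  · intro b c
    simp only [hpl]
    exact he b c
  · intro c v hv
    rw [hpr]
    exact hr c v hv
  · simpa using hh c (Sum.inr (Sum.inl b))
  · simpa [Pi.single_apply, eq_comm] using hh c (Sum.inr (Sum.inr d))
  · simpa using hh c (Sum.inl n)

end Adapted

theorem natCard_subtype_fst {S Z : Type*} (P : S → Prop) :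
    Nat.card {s : S × Z // P s.1} = Nat.card {s // P s} * Nat.card Z := by
  rw [← Nat.card_prod]
  exact Nat.card_congr
    { toFun := fun s => (⟨s.1.1, s.2⟩, s.1.2)
      invFun := fun s => ⟨(s.1.1, s.2), s.1.2⟩
      left_inv := fun _ => rfl
      right_inv := fun _ => rfl }

/-! ### Gram matrices of the dual families in coordinates. -/

section DualCount

open Matrix

variable {K : Type*} [Field K] [StarRing K] {V : Type*} [AddCommGroup V] [Module K V]
  {f : V →ₗ[K] V →ₗ⋆[K] K} {π : Submodule K V} {α ι ν : Type} [DecidableEq α] [DecidableEq ι]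
  [DecidableEq ν] [Fintype ι] [Fintype ν]

namespace AdaptedBasis

/-- A family dual to the basis of `π`. -/
noncomputable def base (B : AdaptedBasis f π α ι ν) : α ⊕ ι → V :=
  Sum.elim (fun b => B.p (Sum.inl b)) B.h

/-- The families dual to the basis of `π`, in coordinates. -/
noncomputable def family (B : AdaptedBasis f π α ι ν) (X : Matrix (α ⊕ ι) ι K)
    (Y : Matrix (α ⊕ ι) ν K) (a : α ⊕ ι) : V :=
  B.base a + ∑ c, X a c • (B.p (Sum.inr c) : V) + ∑ n, Y a n • B.w n

variable (B : AdaptedBasis f π α ι ν)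

theorem base_apply_p (hf : IsHermitianForm f) (a b : α ⊕ ι) :
    f (B.base a) (B.p b : V) = if a = b then 1 else 0 := by
  rcases a with a | c <;> rcases b with b | d
  · simpa [base] using B.orthonormal_p a b
  · rw [if_neg (by simp), hf.eq_zero_comm]
    exact B.radical_p d _ (B.p (Sum.inl a)).2
  · simpa [base] using B.h_inl c b
  · simpa [base] using B.h_inr c d

theorem base_apply_w (hf : IsHermitianForm f) (a : α ⊕ ι) (n : ν) :
    f (B.base a) (B.w n) = 0 := by
  rcases a with a | c
  · exact hf.eq_zero_comm.1 (B.w_mem n _ (B.p (Sum.inl a)).2)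
  · exact B.h_w c n

theorem sum_add_sum_mem (x : ι → K) (y : ν → K) :
    ∑ c, x c • (B.p (Sum.inr c) : V) + ∑ n, y n • B.w n ∈ formOrth f π :=
  Submodule.add_mem _ (Submodule.sum_mem _ fun c _ => Submodule.smul_mem _ _ (B.radical_p c))
    (Submodule.sum_mem _ fun n _ => Submodule.smul_mem _ _ (B.w_mem n))

theorem family_apply_p (hf : IsHermitianForm f) (X : Matrix (α ⊕ ι) ι K) (Y : Matrix (α ⊕ ι) ν K)
    (a b : α ⊕ ι) : f (B.family X Y a) (B.p b : V) = if a = b then 1 else 0 := by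
  rw [family, add_assoc, map_add, LinearMap.add_apply, B.base_apply_p hf,
    B.sum_add_sum_mem _ _ _ (B.p b).2, add_zero]

theorem apply_base_sum (hf : IsHermitianForm f) (a : α ⊕ ι) (x : ι → K) (y : ν → K) :
    f (B.base a) (∑ c, x c • (B.p (Sum.inr c) : V) + ∑ n, y n • B.w n) =
      Sum.elim (fun _ => 0) (fun c => star (x c)) a := by
  rw [map_add, sesq_sum_right, sesq_sum_right]
  simp only [B.base_apply_p hf, B.base_apply_w hf, mul_zero, Finset.sum_const_zero, add_zero]
  rcases a with a | c <;> simp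

theorem apply_sum_sum (hf : IsHermitianForm f) (x x' : ι → K) (y y' : ν → K) :
    f (∑ c, x c • (B.p (Sum.inr c) : V) + ∑ n, y n • B.w n)
      (∑ c, x' c • (B.p (Sum.inr c) : V) + ∑ n, y' n • B.w n) = ∑ n, y n * star (y' n) := by
  have h1 : ∑ c, x' c • (B.p (Sum.inr c) : V) ∈ π :=
    Submodule.sum_mem _ fun c _ => Submodule.smul_mem _ _ (B.p _).2
  have h2 : ∑ c, x c • (B.p (Sum.inr c) : V) ∈ π :=
    Submodule.sum_mem _ fun c _ => Submodule.smul_mem _ _ (B.p _).2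
  have h3 : ∑ n, y' n • B.w n ∈ formOrth f π :=
    Submodule.sum_mem _ fun c _ => Submodule.smul_mem _ _ (B.w_mem _)
  rw [map_add, B.sum_add_sum_mem x y _ h1, zero_add, map_add, LinearMap.add_apply,
    hf.eq_zero_comm.1 (h3 _ h2), zero_add, B.orthonormal_w.apply_sum_sum]

theorem apply_family_family (hf : IsHermitianForm f) (X : Matrix (α ⊕ ι) ι K)
    (Y : Matrix (α ⊕ ι) ν K)
    (a b : α ⊕ ι) : f (B.family X Y a) (B.family X Y b) = f (B.base a) (B.base b) +
      Sum.elim (fun _ => 0) (fun c => star (X b c)) a + Sum.elim (fun _ => 0) (fun c => X a c) b +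
      ∑ n, Y a n * star (Y b n) := by
  have hadd (u v u' v' : V) : f (u + v) (u' + v') = f u u' + f u v' + (f v u' + f v v') := by
    rw [map_add f, LinearMap.add_apply, map_add, map_add]
  rw [family, family, add_assoc, add_assoc (B.base b), hadd, B.apply_base_sum hf,
    B.apply_sum_sum hf, ← hf.star_apply (B.base b)
      (∑ c, X a c • (B.p (Sum.inr c) : V) + ∑ n, Y a n • B.w n), B.apply_base_sum hf]
  have : star (Sum.elim (fun _ => 0) (fun c => star (X a c)) b : K) =
      Sum.elim (fun _ => 0) (fun c => X a c) b := by
    rcases b with b | c <;> simp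
  rw [this]
  ring

/-- Two dual families differ by vectors of `π^⊥`, on which the radical of `π` and `w` give unique
coordinates. -/
theorem family_bijective (hf : IsHermitianForm f) :
    Function.Bijective fun z : Matrix (α ⊕ ι) ι K × Matrix (α ⊕ ι) ν K =>
      (⟨B.family z.1 z.2, B.family_apply_p hf z.1 z.2⟩ : {t : α ⊕ ι → V //
        ∀ a b, f (t a) (B.p b : V) = if a = b then 1 else 0}) := by
  constructor
  · rintro ⟨X, Y⟩ ⟨X', Y'⟩ h
    have h1 (a : α ⊕ ι) : B.family X Y a = B.family X' Y' a :=
      congrFun (congrArg Subtype.val h) a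
    have h2 (a : α ⊕ ι) : ∑ c, X a c • (B.p (Sum.inr c) : V) + ∑ n, Y a n • B.w n =
        ∑ c, X' a c • (B.p (Sum.inr c) : V) + ∑ n, Y' a n • B.w n := by
      have := h1 a
      rw [family, family, add_assoc, add_assoc] at this
      exact add_left_cancel this
    refine Prod.ext ?_ ?_
    · ext a c
      have := congrArg (f (B.base (Sum.inr c))) (h2 a)
      rw [B.apply_base_sum hf, B.apply_base_sum hf] at this
      exact star_injective this
    · ext a n
      have := congrArg (f.flip (∑ c, (0 : ι → K) c • (B.p (Sum.inr c) : V) +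
        ∑ m, (Pi.single n (1 : K) : ν → K) m • B.w m)) (h2 a)
      rw [LinearMap.flip_apply, LinearMap.flip_apply, B.apply_sum_sum hf,
        B.apply_sum_sum hf] at this
      simpa [Pi.single_apply, apply_ite star] using this
  · rintro ⟨t, ht⟩
    have h1 (a : α ⊕ ι) : t a - B.base a ∈ formOrth f π := by
      have h : formOrth f (Submodule.span K (Set.range fun b => (B.p b : V))) = formOrth f π := by
        have h := congrArg (Submodule.map π.subtype) B.p.span_eq
        rw [Submodule.map_span, Submodule.map_top, Submodule.range_subtype, ← Set.range_comp] at h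
        exact congrArg _ h
      rw [← h, mem_formOrth_span, Set.forall_mem_range]
      intro b
      rw [map_sub, LinearMap.sub_apply, ht, B.base_apply_p hf, sub_self]
    choose X Y hXY using fun a => B.exists_eq _ (h1 a)
    refine ⟨(X, Y), Subtype.ext (funext fun a => ?_)⟩
    change B.base a + ∑ c, X a c • (B.p (Sum.inr c) : V) + ∑ n, Y a n • B.w n = t a
    rw [add_assoc, ← hXY a]
    abel

/-- The Gram matrix of the second half of the base family. -/
noncomputable def gramH : Matrix ι ι K := formGram f B.h

theorem gramH_mem (hf : IsHermitianForm f) : B.gramH ∈ selfAdjoint (Matrix ι ι K) := by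
  rw [selfAdjoint.mem_iff]
  ext c d
  exact hf.star_apply _ _

theorem formGram_family (hf : IsHermitianForm f) (X : Matrix (α ⊕ ι) ι K)
    (Y : Matrix (α ⊕ ι) ν K) : formGram f (B.family X Y) =
      hermCompletion Y.toRows₁ (X.toRows₁ + Y.toRows₁ * Y.toRows₂ᴴ)
        (B.gramH + (X.toRows₂ + star X.toRows₂) + Y.toRows₂ * Y.toRows₂ᴴ) := by
  ext (a | c) (b | d)
  · have h : f (B.base (Sum.inl a)) (B.base (Sum.inl b)) = if a = b then 1 else 0 :=
      B.orthonormal_p a b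
    simp only [formGram, of_apply, B.apply_family_family hf, h, hermCompletion,
      fromBlocks_apply₁₁, Matrix.add_apply, one_apply, mul_apply, conjTranspose_apply,
      Sum.elim_inl, add_zero, toRows₁_apply]
  · have h : f (B.base (Sum.inl a)) (B.base (Sum.inr d)) = 0 := by
      rw [hf.eq_zero_comm]
      exact B.h_inl d a
    simp only [formGram, of_apply, B.apply_family_family hf, h, hermCompletion,
      fromBlocks_apply₁₂, Matrix.add_apply, mul_apply, conjTranspose_apply,
      Sum.elim_inl, Sum.elim_inr, add_zero, zero_add, toRows₁_apply, toRows₂_apply]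
  · have h : f (B.base (Sum.inr c)) (B.base (Sum.inl b)) = 0 := B.h_inl c b
    simp only [formGram, of_apply, B.apply_family_family hf, h, hermCompletion,
      fromBlocks_apply₂₁, Matrix.add_apply, mul_apply, conjTranspose_apply,
      Sum.elim_inl, Sum.elim_inr, add_zero, zero_add, toRows₁_apply, toRows₂_apply,
      star_add, star_sum, star_mul', star_star]
    congr 1
    exact Finset.sum_congr rfl fun _ _ => mul_comm _ _
  · have h : f (B.base (Sum.inr c)) (B.base (Sum.inr d)) = B.gramH c d := rfl
    simp only [formGram, of_apply, B.apply_family_family hf, h, hermCompletion,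
      fromBlocks_apply₂₂, Matrix.add_apply, mul_apply, conjTranspose_apply, star_apply,
      Sum.elim_inr, toRows₂_apply]
    ring

/-- The upper rows of `X` shift `C` freely, and the trace of the lower square of `X` shifts `D`
through all hermitian matrices. What the Gram matrix does not see is the lower part of `Y` and the
second self-adjoint coordinate of that square. -/
theorem exists_equiv_formGram (hf : IsHermitianForm f) :
    ∃ E : Matrix (α ⊕ ι) ι K × Matrix (α ⊕ ι) ν K ≃
      (Matrix α ν K × Matrix α ι K × selfAdjoint (Matrix ι ι K)) ×
        (Matrix ι ν K × selfAdjoint (Matrix ι ι K)),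
      ∀ z, formGram f (B.family z.1 z.2) =
        hermCompletion (E z).1.1 (E z).1.2.1 ((E z).1.2.2 : Matrix ι ι K) := by
  obtain ⟨e, he⟩ := exists_equiv_selfAdjoint_prod hf.exists_star_ne (Matrix ι ι K)
  have hY (Y : Matrix ι ν K) : Y * Yᴴ ∈ selfAdjoint (Matrix ι ι K) :=
    isHermitian_mul_conjTranspose_self Y
  let E : Matrix (α ⊕ ι) ι K × Matrix (α ⊕ ι) ν K ≃
      (Matrix α ν K × Matrix α ι K × selfAdjoint (Matrix ι ι K)) ×
        (Matrix ι ν K × selfAdjoint (Matrix ι ι K)) :=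
    { toFun := fun z =>
        ((z.2.toRows₁, z.1.toRows₁ + z.2.toRows₁ * z.2.toRows₂ᴴ,
          ⟨_, B.gramH_mem hf⟩ + (e z.1.toRows₂).1 + ⟨_, hY z.2.toRows₂⟩),
          z.2.toRows₂, (e z.1.toRows₂).2)
      invFun := fun s => (fromRows (s.1.2.1 - s.1.1 * s.2.1ᴴ)
          (e.symm (s.1.2.2 - ⟨_, hY s.2.1⟩ - ⟨_, B.gramH_mem hf⟩, s.2.2)),
        fromRows s.1.1 s.2.1)
      left_inv := fun z => by
        refine Prod.ext ?_ (fromRows_toRows _)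
        simp only [add_sub_cancel_right, add_sub_cancel_left, Prod.mk.eta, Equiv.symm_apply_apply,
          fromRows_toRows]
      right_inv := fun s => by
        simp only [toRows₁_fromRows, toRows₂_fromRows, Equiv.apply_symm_apply, sub_add_cancel,
          add_sub_cancel] }
  refine ⟨E, fun z => ?_⟩
  have h2 : (((E z).1.2.2 : selfAdjoint (Matrix ι ι K)) : Matrix ι ι K) =
      B.gramH + (z.1.toRows₂ + star z.1.toRows₂) + z.2.toRows₂ * z.2.toRows₂ᴴ := by
    rw [← he]
    rfl
  rw [B.formGram_family hf, h2]
  rfl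

theorem natCard_dual [Fintype α] (hf : IsHermitianForm f) :
    Nat.card {t : α ⊕ ι → V // (∀ a b, f (t a) (B.p b : V) = if a = b then 1 else 0) ∧
      (formGram f t).det ≠ 0} =
    hermCompletionCard K α ι ν * (Nat.card (Matrix ι ν K) *
      Nat.card (selfAdjoint (Matrix ι ι K))) := by
  obtain ⟨E, hE⟩ := B.exists_equiv_formGram hf
  have h1 : Nat.card {t : {t : α ⊕ ι → V // ∀ a b, f (t a) (B.p b : V) = if a = b then 1 else 0} //
      (formGram f t.1).det ≠ 0} = Nat.card {t : α ⊕ ι → V //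
      (∀ a b, f (t a) (B.p b : V) = if a = b then 1 else 0) ∧ (formGram f t).det ≠ 0} :=
    Nat.card_congr (Equiv.subtypeSubtypeEquivSubtypeInter
      (fun t : α ⊕ ι → V => ∀ a b, f (t a) (B.p b : V) = if a = b then 1 else 0)
      fun t => (formGram f t).det ≠ 0)
  have h2 := Nat.card_congr ((Equiv.ofBijective _ (B.family_bijective hf)).subtypeEquiv
    (p := fun z => (formGram f (B.family z.1 z.2)).det ≠ 0)
    (q := fun t => (formGram f t.1).det ≠ 0) fun z => Iff.rfl)
  have h3 := Nat.card_congr (E.subtypeEquiv (p := fun z => (formGram f (B.family z.1 z.2)).det ≠ 0)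
    (q := fun s => (hermCompletion s.1.1 s.1.2.1 (s.1.2.2 : Matrix ι ι K)).det ≠ 0)
    fun z => by rw [hE])
  rw [← h1, ← h2, h3, natCard_subtype_fst fun s : Matrix α ν K × Matrix α ι K ×
    selfAdjoint (Matrix ι ι K) => (hermCompletion s.1 s.2.1 (s.2.2 : Matrix ι ι K)).det ≠ 0,
    Nat.card_prod, hermCompletionCard]

end AdaptedBasis

end DualCount

theorem natCard_eq_pow_finrank {K : Type*} [Field K] [Finite K] {V : Type*} [AddCommGroup V]
    [Module K V] [FiniteDimensional K V] {q : ℕ}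
    (hq : Nat.card K = q ^ 2) : Nat.card V = q ^ (2 * Module.finrank K V) := by
  rw [Nat.card_congr (Module.finBasis K V).equivFun.toEquiv, Nat.card_fun, hq, Nat.card_fin,
    pow_mul]

/-! ### Non-singular subspaces of a possibly degenerate space. -/

section SingularSpaces

variable {K : Type*} [Field K] [StarRing K] {V : Type*} [AddCommGroup V] [Module K V]
  {f : V →ₗ[K] V →ₗ⋆[K] K}

theorem map_subtype_formRadical (U : Submodule K V) :
    (formRadical (f.domRestrict₁₂ U U)).map U.subtype = U ⊓ formOrth f U := by
  ext v
  simp only [Submodule.mem_map, Submodule.mem_inf]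
  constructor
  · rintro ⟨u, hu, rfl⟩
    exact ⟨u.2, mem_formRadical_domRestrict.1 hu⟩
  · rintro ⟨hv, hv'⟩
    exact ⟨⟨v, hv⟩, mem_formRadical_domRestrict.2 hv', rfl⟩

theorem isSingularSpace_iff {i d : ℕ} {U : Submodule K V} : IsSingularSpace f i d U ↔
    Module.finrank K U = d ∧ Module.finrank K (U ⊓ formOrth f U : Submodule K V) = i := by
  rw [IsSingularSpace, ← map_subtype_formRadical, Submodule.finrank_map_subtype_eq]

theorem map_subtype_inf_formOrth (U : Submodule K V) (τ : Submodule K U) :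
    τ.map U.subtype ⊓ formOrth f (τ.map U.subtype) =
      (τ ⊓ formOrth (f.domRestrict₁₂ U U) τ).map U.subtype := by
  ext v
  simp only [Submodule.mem_map, Submodule.mem_inf]
  constructor
  · rintro ⟨⟨u, hu, rfl⟩, h⟩
    exact ⟨u, ⟨hu, fun w hw => h w ⟨w, hw, rfl⟩⟩, rfl⟩
  · rintro ⟨u, ⟨hu, h⟩, rfl⟩
    refine ⟨⟨u, hu, rfl⟩, ?_⟩
    rintro _ ⟨w, hw, rfl⟩
    exact h w hw

theorem isSingularSpace_map_subtype {i d : ℕ} (U : Submodule K V) (τ : Submodule K U) :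
    IsSingularSpace f i d (τ.map U.subtype) ↔
      IsSingularSpace (f.domRestrict₁₂ U U) i d τ := by
  rw [isSingularSpace_iff, isSingularSpace_iff, map_subtype_inf_formOrth,
    Submodule.finrank_map_subtype_eq, Submodule.finrank_map_subtype_eq]

theorem isNondegenerateForm_domRestrict [FiniteDimensional K V] {d : ℕ} {U : Submodule K V}
    (h : IsSingularSpace f 0 d U) : IsNondegenerateForm (f.domRestrict₁₂ U U) :=
  Submodule.finrank_eq_zero.1 h.2

/-- `U` and `U^⊥` have the same radical `U ⊓ U^⊥`. -/
theorem IsHermitianForm.isSingularSpace_formOrth [FiniteDimensional K V] (hf : IsHermitianForm f)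
    (hnd : IsNondegenerateForm f) {i d e : ℕ} (hde : d + e = Module.finrank K V)
    {U : Submodule K V} (h : IsSingularSpace f i d U) : IsSingularSpace f i e (formOrth f U) := by
  rw [isSingularSpace_iff] at h ⊢
  rw [hf.formOrth_formOrth hnd, inf_comm]
  have := hf.finrank_formOrth hnd U
  exact ⟨by omega, h.2⟩

theorem IsOrthonormalFor.finrank_formOrth_span [FiniteDimensional K V] {c : ℕ} {s : Fin c → V}
    (hs : IsOrthonormalFor f s) :
    c + Module.finrank K (formOrth f (Submodule.span K (Set.range s))) = Module.finrank K V := by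
  let g : V →ₗ[K] (Fin c → K) := LinearMap.pi fun b => f.flip (s b)
  have h1 : LinearMap.range g = ⊤ :=
    LinearMap.range_eq_top.2 fun x => ⟨∑ b, x b • s b, funext fun c => hs.apply_sum_left x c⟩
  have h2 : LinearMap.ker g = formOrth f (Submodule.span K (Set.range s)) := by
    ext v
    rw [LinearMap.mem_ker, mem_formOrth_span, Set.forall_mem_range, funext_iff]
    rfl
  rw [← LinearMap.finrank_range_add_finrank_ker g, h1, h2, finrank_top, Module.finrank_pi,
    Fintype.card_fin]

/-- Passing to the orthogonal space of an orthonormal family keeps the radical; this drives the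
vector-by-vector count of orthonormal families. -/
theorem IsOrthonormalFor.inf_formOrth_span {c : ℕ} {s : Fin c → V}
    (hs : IsOrthonormalFor f s) :
    formOrth f (Submodule.span K (Set.range s)) ⊓
      formOrth f (formOrth f (Submodule.span K (Set.range s))) = formRadical f := by
  ext v
  simp only [Submodule.mem_inf, mem_formRadical]
  constructor
  · rintro ⟨hv, hv'⟩ w
    have hw : w - ∑ b, f w (s b) • s b ∈ formOrth f (Submodule.span K (Set.range s)) := by
      rw [mem_formOrth_span, Set.forall_mem_range]
      intro b
      rw [map_sub, LinearMap.sub_apply, hs.apply_sum_left, sub_self]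
    rw [mem_formOrth_span, Set.forall_mem_range] at hv
    have h := hv' _ hw
    rw [map_sub, sesq_sum_right] at h
    simpa [hv] using h
  · exact fun h => ⟨fun w _ => h w, fun w _ => h w⟩

variable [Finite K] [FiniteDimensional K V]

/-- The radical component of a vector is free and does not affect its norm. -/
theorem IsHermitianForm.natCard_apply_self_eq_of_radical (hf : IsHermitianForm f) {q : ℕ}
    (hq : Nat.card K = q ^ 2) {a ρ : ℕ} (hρ : Module.finrank K (formRadical f) = ρ)
    (ha : Module.finrank K V = a + ρ) (s : K) :
    Nat.card {v : V // f v v = s} = q ^ (2 * ρ) * sphereCard a s := by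
  obtain ⟨a', e, he, her⟩ := hf.exists_isOrthonormalFor
  have ha' := he.finrank_eq her
  rw [Fintype.card_fin, hρ, ha, add_left_inj] at ha'
  subst ha'
  have hrad (v : formRadical f) (w : V) : f v w = 0 := (mem_formRadical f v).1 v.2 w
  have hrad' (v : formRadical f) (w : V) : f w v = 0 := hf.eq_zero_comm.1 (hrad v w)
  let E : V ≃ (Fin a → K) × formRadical f :=
    { toFun := fun v => (fun b => f v (e b), ⟨_, her v⟩)
      invFun := fun x => ∑ b, x.1 b • e b + x.2
      left_inv := fun v => by simp
      right_inv := fun x => by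
        have h : (fun b => f (∑ b, x.1 b • e b + (x.2 : V)) (e b)) = x.1 := by
          ext b
          rw [map_add, LinearMap.add_apply, he.apply_sum_left, hrad, add_zero]
        refine Prod.ext h (Subtype.ext ?_)
        change _ - ∑ b, (fun b => f (∑ b, x.1 b • e b + (x.2 : V)) (e b)) b • e b = _
        rw [h]
        exact add_sub_cancel_left _ _ }
  have hE (x) : f (E.symm x) (E.symm x) = ∑ b, x.1 b * star (x.1 b) := by
    change f (∑ b, x.1 b • e b + (x.2 : V)) (∑ b, x.1 b • e b + (x.2 : V)) = _
    rw [map_add, hrad', add_zero, map_add, LinearMap.add_apply, hrad, add_zero,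
      he.apply_sum_sum]
  rw [Nat.card_congr (E.subtypeEquiv (q := fun x => ∑ b, x.1 b * star (x.1 b) = s) fun v => by
    rw [← hE, E.symm_apply_apply]),
    natCard_subtype_fst fun x : Fin a → K => ∑ b, x b * star (x b) = s,
    natCard_eq_pow_finrank (V := formRadical f) hq, hρ, mul_comm, sphereCard]

/-- The number of orthonormal families of `c` vectors. -/
theorem IsHermitianForm.natCard_isOrthonormalFor (hf : IsHermitianForm f) {q : ℕ}
    (hq : Nat.card K = q ^ 2) {a ρ : ℕ} (hρ : Module.finrank K (formRadical f) = ρ)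
    (ha : Module.finrank K V = a + ρ) (c : ℕ) (hc : c ≤ a) :
    Nat.card {s : Fin c → V // IsOrthonormalFor f s} =
      ∏ t ∈ Finset.range c, (q ^ (2 * ρ) * sphereCard (a - t) (1 : K)) := by
  classical
  have : Finite V := Module.finite_of_finite K
  induction c with
  | zero =>
    rw [Finset.prod_range_zero, Nat.card_eq_one_iff_unique]
    exact ⟨inferInstance, ⟨⟨Fin.elim0, fun b => b.elim0⟩⟩⟩
  | succ c ih =>
    have := Fintype.ofFinite (Fin c → V)
    have h1 : Nat.card {s : Fin (c + 1) → V // IsOrthonormalFor f s} =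
        Nat.card {x : (Fin c → V) × V // IsOrthonormalFor f x.1 ∧
          (x.2 ∈ formOrth f (Submodule.span K (Set.range x.1)) ∧ f x.2 x.2 = 1)} := by
      refine Nat.card_congr (((Fin.consEquiv fun _ : Fin (c + 1) => V).symm.trans
        (Equiv.prodComm _ _)).subtypeEquiv fun s => ?_)
      obtain ⟨⟨v, s⟩, rfl⟩ := (Fin.consEquiv fun _ : Fin (c + 1) => V).surjective s
      simp only [Equiv.trans_apply, Equiv.symm_apply_apply, Equiv.prodComm_apply, Prod.swap_prod_mk]
      rw [mem_formOrth_span, Set.forall_mem_range]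
      constructor
      · intro h
        refine ⟨fun b b' => ?_, fun b => ?_, ?_⟩
        · simpa using h b.succ b'.succ
        · simpa [(Fin.succ_ne_zero b).symm] using h 0 b.succ
        · simpa using h 0 0
      · rintro ⟨h, h', h''⟩ b b'
        refine Fin.cases ?_ (fun b => ?_) b <;> refine Fin.cases ?_ (fun b' => ?_) b'
        · simpa using h''
        · simpa [(Fin.succ_ne_zero b').symm] using h' b'
        · simpa [Fin.succ_ne_zero b] using hf.eq_zero_comm.1 (h' b)
        · simpa using h b b'
    rw [h1, natCard_subtype_prod fun (s : Fin c → V) (v : V) => IsOrthonormalFor f s ∧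
      (v ∈ formOrth f (Submodule.span K (Set.range s)) ∧ f v v = 1)]
    have h2 (s : Fin c → V) : Nat.card {v : V // IsOrthonormalFor f s ∧
        (v ∈ formOrth f (Submodule.span K (Set.range s)) ∧ f v v = 1)} =
        if IsOrthonormalFor f s then q ^ (2 * ρ) * sphereCard (a - c) (1 : K) else 0 := by
      split_ifs with hs
      · have h3 := hs.finrank_formOrth_span
        have h4 := Submodule.finrank_map_subtype_eq (formOrth f (Submodule.span K (Set.range s)))
          (formRadical (f.domRestrict₁₂ (formOrth f (Submodule.span K (Set.range s)))
            (formOrth f (Submodule.span K (Set.range s)))))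
        rw [map_subtype_formRadical, hs.inf_formOrth_span, hρ] at h4
        rw [← (hf.domRestrict _).natCard_apply_self_eq_of_radical hq h4.symm
          (a := a - c) (by omega) 1]
        exact Nat.card_congr
          { toFun := fun v => ⟨⟨v.1, v.2.2.1⟩, v.2.2.2⟩
            invFun := fun v => ⟨v.1.1, hs, v.1.2, v.2⟩
            left_inv := fun _ => rfl
            right_inv := fun _ => rfl }
      · rw [Nat.card_eq_zero]
        exact Or.inl ⟨fun v => hs v.2.1⟩
    rw [Finset.sum_congr rfl fun s _ => h2 s, ← Finset.sum_filter, Finset.sum_const, smul_eq_mul,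
      Finset.prod_range_succ, ← ih (by omega), 
      Nat.subtype_card (Finset.univ.filter fun s => IsOrthonormalFor f s) (by simp)]

/-- Double counting of the orthonormal bases of the non-singular `c`-spaces. -/
theorem IsHermitianForm.ncard_nonsingular_mul (hf : IsHermitianForm f) {q : ℕ}
    (hq : Nat.card K = q ^ 2) {a ρ : ℕ} (hρ : Module.finrank K (formRadical f) = ρ)
    (ha : Module.finrank K V = a + ρ) (c : ℕ) (hc : c ≤ a) :
    {τ : Submodule K V | IsSingularSpace f 0 c τ}.ncard *
      ∏ t ∈ Finset.range c, sphereCard (c - t) (1 : K) =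
      ∏ t ∈ Finset.range c, (q ^ (2 * ρ) * sphereCard (a - t) (1 : K)) := by
  classical
  have : Finite V := Module.finite_of_finite K
  have hspan (s : {s : Fin c → V // IsOrthonormalFor f s}) :
      IsSingularSpace f 0 c (Submodule.span K (Set.range s.1)) := by
    refine isSingularSpace_zero_iff.2 ⟨?_, fun u hu hw => ?_⟩
    · rw [finrank_span_eq_card s.2.linearIndependent, Fintype.card_fin]
    · obtain ⟨x, rfl⟩ := (Submodule.mem_span_range_iff_exists_fun K).1 hu
      refine Finset.sum_eq_zero fun b _ => ?_
      have := hw _ (Submodule.subset_span ⟨b, rfl⟩)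
      rw [s.2.apply_sum_left] at this
      rw [this, zero_smul]
  let g : {s : Fin c → V // IsOrthonormalFor f s} →
      {τ : Submodule K V | IsSingularSpace f 0 c τ} := fun s => ⟨_, hspan s⟩
  have := Fintype.ofFinite {τ : Submodule K V | IsSingularSpace f 0 c τ}
  rw [← hf.natCard_isOrthonormalFor hq hρ ha c hc, ← Nat.card_coe_set_eq,
    ← Nat.card_congr (Equiv.sigmaFiberEquiv g), Nat.card_sigma]
  -- The fibre over `τ` consists of the orthonormal bases of `τ`, where the radical is zero.
  have hfib (τ : {τ : Submodule K V | IsSingularSpace f 0 c τ}) :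
      Nat.card {s // g s = τ} = ∏ t ∈ Finset.range c, sphereCard (c - t) (1 : K) := by
    have h1 := (hf.domRestrict τ.1).natCard_isOrthonormalFor hq τ.2.2
      (a := c) (by rw [τ.2.1, add_zero]) c le_rfl
    rw [mul_zero, pow_zero] at h1
    simp only [one_mul] at h1
    rw [← h1]
    have hmem (s : {s // g s = τ}) (b : Fin c) : s.1.1 b ∈ τ.1 := by
      have h : Submodule.span K (Set.range s.1.1) = τ.1 := congrArg Subtype.val s.2
      exact h.le (Submodule.subset_span ⟨b, rfl⟩)
    have hg (s : {s : Fin c → τ.1 // IsOrthonormalFor (f.domRestrict₁₂ τ.1 τ.1) s}) :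
        g ⟨fun b => (s.1 b : V), fun b b' => s.2 b b'⟩ = τ := by
      refine Subtype.ext (Submodule.eq_of_le_of_finrank_eq (Submodule.span_le.2 ?_) ?_)
      · rintro _ ⟨b, rfl⟩
        exact (s.1 b).2
      · exact (g _).2.1.trans τ.2.1.symm
    exact Nat.card_congr
      { toFun := fun s => ⟨fun b => ⟨_, hmem s b⟩, fun b b' => s.1.2 b b'⟩
        invFun := fun s => ⟨_, hg s⟩
        left_inv := fun _ => rfl
        right_inv := fun _ => rfl }
  rw [Finset.sum_congr rfl fun τ _ => hfib τ, Finset.sum_const, Finset.card_univ, smul_eq_mul,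
    Nat.card_eq_fintype_card]

end SingularSpaces

/-! ### The factorisation, and the value of `β`. -/

section Counting

variable {K : Type*} [Field K] [StarRing K] {V : Type*} [AddCommGroup V] [Module K V]
  {f : V →ₗ[K] V →ₗ⋆[K] K} {π : Submodule K V} {i j k q : ℕ}

theorem isSingularSpace_comap_subtype {ω : Submodule K V} (hπω : π ≤ ω)
    (hπ : IsSingularSpace f i j π) :
    IsSingularSpace (f.domRestrict₁₂ ω ω) i j (π.comap ω.subtype) := by
  rwa [← isSingularSpace_map_subtype, Submodule.map_comap_subtype, inf_eq_right.2 hπω]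

variable [FiniteDimensional K V]

/-- Taking orthogonal spaces reverses inclusion and preserves non-singularity. -/
theorem IsHermitianForm.betaCount_eq_ncard (hf : IsHermitianForm f)
    (hnd : IsNondegenerateForm f) {c d : ℕ} (hd : d + c = Module.finrank K V)
    (π : Submodule K V) : betaCount f π d = {τ : Submodule K (formOrth f π) |
      IsSingularSpace (f.domRestrict₁₂ (formOrth f π) (formOrth f π)) 0 c τ}.ncard := by
  let F : Submodule K (formOrth f π) → Submodule K V :=
    fun τ => formOrth f (τ.map (formOrth f π).subtype)
  have hF : Function.Injective F :=
    (Function.LeftInverse.injective (hf.formOrth_formOrth hnd)).comp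
      (Submodule.map_injective_of_injective (formOrth f π).injective_subtype)
  rw [betaCount, ← Set.ncard_image_of_injective _ hF]
  congr 1
  ext σ
  simp only [Set.mem_image, Set.mem_ofPred_eq]
  constructor
  · rintro ⟨hσ, hπσ⟩
    have hle : formOrth f σ ≤ formOrth f π := fun v hv u hu => hv u (hπσ hu)
    have hmap : ((formOrth f σ).comap (formOrth f π).subtype).map (formOrth f π).subtype =
        formOrth f σ := by rw [Submodule.map_comap_subtype, inf_eq_right.2 hle]
    refine ⟨(formOrth f σ).comap (formOrth f π).subtype, ?_, ?_⟩
    · rw [← isSingularSpace_map_subtype, hmap]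
      exact hf.isSingularSpace_formOrth hnd hd hσ
    · change formOrth f (Submodule.map _ _) = _
      rw [hmap, hf.formOrth_formOrth hnd]
  · rintro ⟨τ, hτ, rfl⟩
    rw [← isSingularSpace_map_subtype] at hτ
    refine ⟨hf.isSingularSpace_formOrth hnd (by omega) hτ, fun u hu v hv => ?_⟩
    exact hf.eq_zero_comm.1 (Submodule.map_subtype_le _ _ hv u hu)

/-- The map `σ ↦ π ⊔ σ` is counted fibre by fibre; the fibre over `ω` is the set of complements of
`π` inside `ω`. -/
theorem gammaCount_eq_betaCount_mul [Finite K] {G : ℕ} (hG : ∀ ω : Submodule K V,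
      IsSingularSpace f 0 (k + Module.finrank K π) ω → π ≤ ω →
      gammaCount (f.domRestrict₁₂ ω ω) (π.comap ω.subtype) k = G) :
    gammaCount f π k = betaCount f π (k + Module.finrank K π) * G := by
  classical
  have : Finite V := Module.finite_of_finite K
  let A := {σ : Submodule K V | IsSingularSpace f 0 k σ ∧ σ ⊓ π = ⊥ ∧
    IsSingularSpace f 0 (k + Module.finrank K π) (π ⊔ σ)}
  let B := {ω : Submodule K V | IsSingularSpace f 0 (k + Module.finrank K π) ω ∧ π ≤ ω}
  let g : A → B := fun σ => ⟨π ⊔ σ.1, σ.2.2.2, le_sup_left⟩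
  have := Fintype.ofFinite B
  change A.ncard = B.ncard * G
  have hfib (ω : B) : Nat.card {σ // g σ = ω} = G := by
    obtain ⟨ω, hω, hπω⟩ := ω
    rw [← hG ω hω hπω, gammaCount]
    have hcomap : (π.comap ω.subtype).map ω.subtype = π := by
      rw [Submodule.map_comap_subtype, inf_eq_right.2 hπω]
    have hfin : Module.finrank K (π.comap ω.subtype) = Module.finrank K π := by
      rw [← Submodule.finrank_map_subtype_eq, hcomap]
    have hinj := Submodule.map_injective_of_injective ω.injective_subtype
    rw [← Set.ncard_image_of_injective _ hinj, hfin, ← Nat.card_coe_set_eq]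
    have hbot (τ : Submodule K ω) : τ.map ω.subtype ⊓ π = ⊥ ↔ τ ⊓ π.comap ω.subtype = ⊥ := by
      rw [← hinj.eq_iff, Submodule.map_inf _ ω.injective_subtype, hcomap, Submodule.map_bot]
    have hsup (τ : Submodule K ω) :
        (π.comap ω.subtype ⊔ τ).map ω.subtype = π ⊔ τ.map ω.subtype := by
      rw [Submodule.map_sup, hcomap]
    refine Nat.card_congr
      { toFun := fun σ => ⟨σ.1.1, σ.1.1.comap ω.subtype, ?_⟩
        invFun := fun σ => ⟨⟨σ.1, ?_⟩, ?_⟩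
        left_inv := fun _ => rfl
        right_inv := fun _ => rfl }
    · obtain ⟨⟨σ, h1, h2, h3⟩, h4⟩ := σ
      have h5 : π ⊔ σ = ω := congrArg Subtype.val h4
      have h6 : (σ.comap ω.subtype).map ω.subtype = σ := by
        rw [Submodule.map_comap_subtype, inf_eq_right.2 (le_sup_right.trans h5.le)]
      refine ⟨⟨?_, ?_, ?_⟩, h6⟩
      · rwa [← isSingularSpace_map_subtype, h6]
      · rwa [← hbot, h6]
      · rwa [← isSingularSpace_map_subtype, hsup, h6]
    · obtain ⟨_, τ, ⟨h1, h2, h3⟩, rfl⟩ := σ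
      refine ⟨(isSingularSpace_map_subtype _ _).2 h1, (hbot τ).2 h2, ?_⟩
      rw [← hsup]
      exact (isSingularSpace_map_subtype _ _).2 h3
    · obtain ⟨_, τ, ⟨h1, h2, h3⟩, rfl⟩ := σ
      refine Subtype.ext ?_
      change π ⊔ τ.map ω.subtype = ω
      rw [← hsup, Submodule.eq_top_of_finrank_eq (h3.1.trans hω.1.symm), Submodule.map_top,
        Submodule.range_subtype]
  rw [← Nat.card_coe_set_eq, ← Nat.card_coe_set_eq, ← Nat.card_congr (Equiv.sigmaFiberEquiv g),
    Nat.card_sigma, Finset.sum_congr rfl fun ω _ => hfib ω, Finset.sum_const, Finset.card_univ,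
    smul_eq_mul, Nat.card_eq_fintype_card]

variable [Finite K]

theorem IsHermitianForm.le_of_isSingularSpace (hf : IsHermitianForm f)
    (hnd : IsNondegenerateForm f) (hk : Module.finrank K V = k + j)
    (hπ : IsSingularSpace f i j π) : i ≤ k := by
  obtain ⟨a, N, -, h, -⟩ := hf.exists_adaptedBasis hnd hπ
  omega

/-- The right-hand side depends only on `i`, `j`, `k` and `K`, which is why any form and any `π` of
this type serve to compute `γ`. The last two factors count the coordinates invisible to the Gram
matrix. -/
theorem IsHermitianForm.gammaCount_eq_of_finrank (hf : IsHermitianForm f)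
    (hnd : IsNondegenerateForm f) (hq : Nat.card K = q ^ 2) (hk : Module.finrank K V = k + j)
    (hπ : IsSingularSpace f i j π) : gammaCount f π k =
      hermCompletionCard K (Fin (j - i)) (Fin i) (Fin (k - i)) *
        (q ^ (2 * i * (k - i)) * q ^ (i ^ 2)) := by
  obtain ⟨a, N, rfl, h, ⟨B⟩⟩ := hf.exists_adaptedBasis hnd hπ
  obtain rfl : k = N + i := by omega
  rw [hf.gammaCount_eq_natCard_dual hnd B.p (by rw [hπ.1, hk]), B.natCard_dual hf,
    natCard_selfAdjoint_matrix hf.exists_star_ne hq, Fintype.card_fin, Nat.add_sub_cancel,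
    Nat.add_sub_cancel]
  congr 2
  rw [Matrix, Nat.card_fun, Nat.card_fun, hq, Nat.card_fin, Nat.card_fin, ← pow_mul, ← pow_mul]
  ring_nf

theorem IsHermitianForm.gammaCount_eq_mul (hf : IsHermitianForm f) (hq : Nat.card K = q ^ 2)
    (hπ : IsSingularSpace f i j π) : gammaCount f π k = betaCount f π (k + j) *
      (hermCompletionCard K (Fin (j - i)) (Fin i) (Fin (k - i)) *
        (q ^ (2 * i * (k - i)) * q ^ (i ^ 2))) := by
  obtain rfl := hπ.1
  refine gammaCount_eq_betaCount_mul fun ω hω hπω => ?_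
  exact (hf.domRestrict ω).gammaCount_eq_of_finrank (isNondegenerateForm_domRestrict hω) hq hω.1
    (isSingularSpace_comap_subtype hπω hπ)

theorem IsHermitianForm.betaCount_eq_zero (hf : IsHermitianForm f)
    (hπ : IsSingularSpace f i j π) (hki : k < i) : betaCount f π (k + j) = 0 := by
  have : Finite V := Module.finite_of_finite K
  rw [betaCount, Set.ncard_eq_zero, Set.eq_empty_iff_forall_notMem]
  rintro ω ⟨hω, hπω⟩
  have := (hf.domRestrict ω).le_of_isSingularSpace (isNondegenerateForm_domRestrict hω) hω.1
    (isSingularSpace_comap_subtype hπω hπ)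
  omega

theorem prod_range_sub_eq_prod_Icc {M : Type*} [CommMonoid M] (g : ℕ → M) (b c : ℕ) :
    ∏ t ∈ Finset.range c, g (b + c - t) = ∏ t ∈ Finset.Icc (b + 1) (b + c), g t := by
  induction c with
  | zero => simp
  | succ c ih =>
    rw [Finset.prod_range_succ', ← add_assoc, Finset.prod_Icc_succ_top (by omega), ← ih,
      Nat.sub_zero]
    congr 1
    exact Finset.prod_congr rfl fun t _ => by rw [Nat.add_sub_add_right]

/-- The middle product does not involve `b`, so it cancels unevaluated when the case `b = 0` is
divided out in `betaCount_eq`. -/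
theorem prod_sphereCard (hs : ∃ x : K, star x ≠ x) (hq : Nat.card K = q ^ 2) (b c : ℕ) :
    (∏ t ∈ Finset.range c, sphereCard (b + c - t) (1 : K) : ℚ) =
      (q : ℚ) ^ (b * c) * (∏ t ∈ Finset.range c, (q : ℚ) ^ (c - t - 1)) *
        phiMinus (b + 1) (b + c) q := by
  have hq0 : (q : ℚ) ≠ 0 := by
    have := two_le_of_natCard hq
    positivity
  rw [phiMinus, ← prod_range_sub_eq_prod_Icc (fun t => (q : ℚ) ^ t - (-1) ^ t), pow_mul,
    ← Finset.card_range c, ← Finset.prod_const, Finset.card_range, ← Finset.prod_mul_distrib,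
    ← Finset.prod_mul_distrib]
  refine Finset.prod_congr rfl fun t ht => ?_
  rw [Finset.mem_range] at ht
  rw [sphereCard_eq_of_ne_zero hs hq _ (star_one K) one_ne_zero]
  congr 1
  rw [← pow_add, show b + c - t = (b + (c - t - 1)) + 1 by omega, pow_succ]
  field_simp

/-- In `π^⊥`, of dimension `k + c` with an `i`-dimensional radical, the `c`-spaces are counted by a
ratio of numbers of orthonormal families; the radical contributes `q ^ (2 * i * c)`. -/
theorem IsHermitianForm.betaCount_eq (hf : IsHermitianForm f) (hnd : IsNondegenerateForm f)
    (hq : Nat.card K = q ^ 2) {c : ℕ} (hn : Module.finrank K V = k + j + c)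
    (hπ : IsSingularSpace f i j π) (hik : i ≤ k) :
    (betaCount f π (k + j) : ℚ) = (q : ℚ) ^ (c * (k + i)) * gaussMinus (k - i + c) c q := by
  obtain ⟨b, rfl⟩ := Nat.exists_eq_add_of_le' hik
  have hU := hf.isSingularSpace_formOrth hnd (e := b + i + c) (by omega) hπ
  have h1 := (hf.domRestrict (formOrth f π)).ncard_nonsingular_mul hq hU.2 (a := b + c)
    (by rw [hU.1]; ring) c (by omega)
  rw [← hf.betaCount_eq_ncard hnd (d := b + i + j) (by omega)] at h1
  have h2 := congrArg (Nat.cast (R := ℚ)) h1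
  have hq0 : (q : ℚ) ≠ 0 := by
    have := two_le_of_natCard hq
    positivity
  have h3 := prod_sphereCard (K := K) hf.exists_star_ne hq 0 c
  simp only [zero_add, zero_mul, pow_zero, one_mul] at h3
  push_cast at h2
  rw [Finset.prod_mul_distrib, Finset.prod_const, Finset.card_range, ← pow_mul, h3,
    prod_sphereCard hf.exists_star_ne hq b c] at h2
  have hP : (∏ t ∈ Finset.range c, (q : ℚ) ^ (c - t - 1)) ≠ 0 :=
    Finset.prod_ne_zero_iff.2 fun t _ => pow_ne_zero _ hq0
  have hM : phiMinus 1 c q ≠ 0 := 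
    phiMinus_one_ne_zero (by exact_mod_cast two_le_of_natCard hq) c
  rw [gaussMinus, if_pos (by omega), Nat.add_sub_cancel, Nat.add_sub_cancel, mul_div_assoc',
    eq_div_iff hM]
  refine mul_left_cancel₀ hP ?_
  rw [show c * (b + i + i) = 2 * i * c + b * c by ring, pow_add]
  linear_combination h2

end Counting

/-! ### Assembly of the final formula. -/

theorem phiPlus_one_mul_sum {q : ℚ} (hq : q ≠ 0) {i j k : ℕ} (hij : i ≤ j) (hik : i ≤ k) :
    phiPlus 1 i q * ∑ m ∈ Finset.range (j - i + 1),
      (-1) ^ (m * k) * phiPlus (i + 1) (j - m) q * gaussMinus (j - i) m q *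
        q ^ ((m.choose 2 : ℤ) - (m : ℤ) * ((k : ℤ) - i)) = completionSum q (j - i) i (k - i) := by
  rw [completionSum, Finset.mul_sum]
  refine Finset.sum_congr rfl fun m hm => ?_
  rw [Finset.mem_range] at hm
  rw [Nat.sub_add_cancel hij, Nat.sub_add_cancel hik, ← phiPlus_one_mul (show i ≤ j - m by omega),
    ← Nat.cast_sub hik, ← Nat.cast_mul, zpow_sub₀ hq, zpow_natCast, zpow_natCast, div_eq_mul_inv]
  ring

theorem IsHermitianForm.gammaCount_eq {K : Type*} [Field K] [StarRing K] [Finite K] {V : Type*}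
    [AddCommGroup V] [Module K V] [FiniteDimensional K V] {f : V →ₗ[K] V →ₗ⋆[K] K}
    (hf : IsHermitianForm f) (hnd : IsNondegenerateForm f) {q : ℕ} (hq : Nat.card K = q ^ 2)
    {i j k c : ℕ} (hn : Module.finrank K V = k + j + c) (hij : i ≤ j) (hik : i ≤ k)
    {π : Submodule K V} (hπ : IsSingularSpace f i j π) : (gammaCount f π k : ℚ) =
      (q : ℚ) ^ ((c : ℤ) * (k + i) + 2 * j * k - ((j + 1).choose 2 : ℤ)) *
        gaussMinus (k - i + c) c q * completionSum q (j - i) i (k - i) := by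
  have hq0 : (q : ℚ) ≠ 0 := by
    have := two_le_of_natCard hq
    positivity
  rw [hf.gammaCount_eq_mul hq hπ, Nat.cast_mul, hf.betaCount_eq hnd hq hn hπ hik]
  have h := hermCompletionCard_eq (K := K) hf.exists_star_ne hq (j - i) i (k - i)
  rw [Nat.sub_add_cancel hij] at h
  rw [show (c : ℤ) * (k + i) + 2 * j * k = ((c * (k + i) + 2 * j * k : ℕ) : ℤ) by push_cast; rfl,
    zpow_sub₀ hq0, zpow_natCast, zpow_natCast, pow_add]
  -- The first three terms come from `hermCompletionCard_eq`, the bracket from the invisible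
  -- coordinates.
  have h2 : 2 * j * k = 2 * (j - i) * (k - i) + 2 * (j - i) * i + i ^ 2 +
      (2 * i * (k - i) + i ^ 2) := by
    obtain ⟨a, rfl⟩ := Nat.exists_eq_add_of_le' hij
    obtain ⟨N, rfl⟩ := Nat.exists_eq_add_of_le' hik
    rw [Nat.add_sub_cancel, Nat.add_sub_cancel]
    ring
  rw [h2, pow_add _ (_ + _ + _), pow_add _ (2 * i * (k - i)), div_mul_eq_mul_div,
    div_mul_eq_mul_div, eq_div_iff (pow_ne_zero _ hq0)]
  push_cast
  linear_combination ((q : ℚ) ^ (c * (k + i)) * gaussMinus (k - i + c) c q *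
    ((q : ℚ) ^ (2 * i * (k - i)) * (q : ℚ) ^ (i ^ 2))) * h

/-- Turning `θ` into a star operation makes conjugate transposes and self-adjoint matrices
available. -/
theorem IsHermitianForm.exists_starRing {K : Type*} [Field K] {θ : K →+* K} {V : Type*}
    [AddCommGroup V] [Module K V] {f : V →ₗ[K] V →ₛₗ[θ] K} (hf : IsHermitianForm f) :
    ∃ _inst : StarRing K, θ = starRingEnd K :=
  ⟨{ star := θ
     star_involutive := hf.involutive
     star_mul := fun x y => by rw [map_mul, mul_comm]
     star_add := map_add θ }, rfl⟩

theorem mainTheorem1 {K : Type*} [Field K] [Finite K] (q : ℕ) (hq : Nat.card K = q ^ 2)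
    (θ : K →+* K) (i j n k : ℕ) (hij : i ≤ j) (hin : i ≤ n - j) (hjn : j < n) (hk : k ≤ n - j)
    (f : (Fin n → K) →ₗ[K] (Fin n → K) →ₛₗ[θ] K)
    (hf : IsHermitianForm f) (hfnd : IsNondegenerateForm f)
    (π : Submodule K (Fin n → K)) (hπ : IsSingularSpace f i j π) :
    -- `γ_{i,j,n,k} = β_{i,j,n,k+j} γ_{i,j,k+j}`, where `γ_{i,j,k+j}` may be computed from any
    -- non-degenerate hermitian form `g` and any `i`-singular `j`-space `π'`
    (∀ (g : (Fin (k + j) → K) →ₗ[K] (Fin (k + j) → K) →ₛₗ[θ] K)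
        (π' : Submodule K (Fin (k + j) → K)),
        IsHermitianForm g → IsNondegenerateForm g → IsSingularSpace g i j π' →
        gammaCount f π k = betaCount f π (k + j) * gammaCount g π' k) ∧
    -- if `k < i` there is no such `π'`, and the product is zero through its first factor
    (k < i → gammaCount f π k = 0 ∧ betaCount f π (k + j) = 0) ∧
    (gammaCount f π k : ℚ) =
      (q : ℚ) ^ (((n : ℤ) - k - j) * (k + i) + 2 * j * k - ((j + 1).choose 2 : ℤ)) *
        gaussMinus (n - j - i) (n - k - j) q * phiPlus 1 i q *
        ∑ m ∈ Finset.range (j - i + 1),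
          (-1) ^ (m * k) * phiPlus (i + 1) (j - m) q * gaussMinus (j - i) m q *
            (q : ℚ) ^ ((m.choose 2 : ℤ) - (m : ℤ) * ((k : ℤ) - i)) := by
  obtain ⟨_, rfl⟩ := hf.exists_starRing
  have hfin (m : ℕ) : Module.finrank K (Fin m → K) = m := Module.finrank_fin_fun K
  refine ⟨fun g π' hg hgnd hπ' => ?_, fun hki => ?_, ?_⟩
  · rw [hf.gammaCount_eq_mul hq hπ, hg.gammaCount_eq_of_finrank hgnd hq (hfin _) hπ']
  · have h := hf.betaCount_eq_zero hπ hki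
    rw [hf.gammaCount_eq_mul hq hπ, h, zero_mul]
    exact ⟨rfl, rfl⟩
  · obtain ⟨c, rfl⟩ : ∃ c, n = k + j + c := ⟨n - k - j, by omega⟩
    rw [show k + j + c - k - j = c by omega]
    rcases lt_or_ge k i with hki | hik
    -- For `k < i` the Gaussian coefficient is zero since `n - j - i < c`; `hin` ensures that the
    -- subtraction is not truncated.
    · rw [hf.gammaCount_eq_mul hq hπ, hf.betaCount_eq_zero hπ hki, zero_mul, Nat.cast_zero,
        gaussMinus, if_neg (by omega), mul_zero, zero_mul, zero_mul]
    · have hq0 : (q : ℚ) ≠ 0 := by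
        have := two_le_of_natCard hq
        positivity
      rw [mul_assoc _ (phiPlus 1 i q), phiPlus_one_mul_sum hq0 hij hik,
        hf.gammaCount_eq hfnd hq (hfin _) hij hik hπ,
        show k + j + c - j - i = k - i + c by omega]
      congr 4
      push_cast
      ring
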